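/- Let $d\ge 2$, let $A\neq 0$ be a positive semidefinite real $d\times d$ matrix, and let $\tilde A_1,\tilde A_2,\ldots$ be i.i.d. random positive semidefinite matrices with $\mathbb E[\tilde A_t]=A$ such that, for some $b\ge 1$, $\|\tilde A_t\|/\|A\|\le b$ and $\|\tilde A_t-A\|/\|A\|\le b$ with probability $1$ ($\|\cdot\|$ is the spectral norm, $\|\cdot\|_F$ the Frobenius norm). Let $n_A=\|A\|_F^2/\|A\|^2$ be the numerical rank of $A$. There are positive numerical constants $c,C,q,c_1,c_1',c_2,c_2'$, independent of all other quantities, such that the following holds for all integers $T_0\ge c\,d\,b^2\log d$ and $T\ge 2$. Let $w$ be a standard Gaussian vector in $\mathbb R^d$, independent of the samples, and initialize by one approximate power iteration on the first $T_0$ samples, $w_0=\tilde A w/\|\tilde A w\|$ with $\tilde A=\frac1{T_0}\sum_{t=1}^{T_0}\tilde A_t$. Put $p=C\log(d)\,n_A$ and $\eta=\frac{1}{b\|A\|\sqrt{pT}}$, iterate $w_t=(I+\eta\tilde A_{T_0+t})w_{t-1}$ for $t=1,\ldots,T$ on the next $T$ samples, and return $\hat w=w_T/\|w_T\|$. Then: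 (1) $p\ge 8$ and $\eta\|A\|\le 1$; and for every unit leading eigenvector $v$ of $A$, the event $G_v=\{\langle v,w_0\rangle\ne0,\ 1/\langle v,w_0\rangle^2\le p\}$ has probability at least $q$, and conditionally on $G_v$, with probability at least $\frac1{c_1p}$, $$1-\frac{\hat w^\top A\hat w}{\|A\|}\le c_1'\,\frac{\log(T)\,b\sqrt p}{\sqrt T}.$$ (2) Consequently, with probability at least $\frac{c_2}{n_A\log d}$, the returned $\hat w$ is a well-defined unit vector and $$1-\frac{\hat w^\top A\hat w}{\|A\|}\le c_2'\,\frac{\log(T)\,b\sqrt{\log(d)\,n_A}}{\sqrt T}.$$ -/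

import Mathlib

open MeasureTheory ProbabilityTheory
open scoped Matrix.Norms.L2Operator

noncomputable section

namespace StreamPCA

/-- The Borel (= product) sigma-algebra on real `d × d` matrices, that is, the one generated by
the entries. -/
instance instMeasurableSpaceMatrix (d : ℕ) : MeasurableSpace (Matrix (Fin d) (Fin d) ℝ) :=
  MeasurableSpace.pi

/-- Euclidean space `ℝ^d`. -/
abbrev Vec (d : ℕ) : Type := EuclideanSpace ℝ (Fin d)

/-- The matrix-vector product `M x`, with `x` and `M x` in Euclidean space. -/
def app {d : ℕ} (M : Matrix (Fin d) (Fin d) ℝ) (x : Vec d) : Vec d :=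
  Matrix.toEuclideanCLM (n := Fin d) (𝕜 := ℝ) M x

/-- `x / ‖x‖` (and `0` if `x = 0`). -/
def unitize {d : ℕ} (x : Vec d) : Vec d := ‖x‖⁻¹ • x

/-- The numerical rank `n_A = ‖A‖_F² / ‖A‖²`; here `‖A‖` is the spectral norm. -/
def numRank {d : ℕ} (A : Matrix (Fin d) (Fin d) ℝ) : ℝ :=
  (∑ i, ∑ j, A i j ^ 2) / ‖A‖ ^ 2

/-- `v` is a (normalized) leading eigenvector of `A`: a unit eigenvector whose eigenvalue is the
largest one of `A`. -/
def IsLeadingEigenvector {d : ℕ} (A : Matrix (Fin d) (Fin d) ℝ) (v : Vec d) : Prop :=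
  ‖v‖ = 1 ∧ ∃ s : ℝ, app A v = s • v ∧ ∀ (s' : ℝ) (u : Vec d), u ≠ 0 → app A u = s' • u → s' ≤ s

/-- One approximate power iteration from `w`: the normalization of `((1/T₀) ∑_{t < T₀} B t) w`. -/
def powerInit {d : ℕ} (T₀ : ℕ) (B : ℕ → Matrix (Fin d) (Fin d) ℝ) (w : Vec d) : Vec d :=
  unitize (app ((1 / (T₀ : ℝ)) • ∑ t ∈ Finset.range T₀, B t) w)

/-- The iterates of SGD: `w_t = (I + η B_t) w_{t-1}`, where the sample that is used in the
`(t+1)`-st step is `B t`. -/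
def sgdIter {d : ℕ} (η : ℝ) (B : ℕ → Matrix (Fin d) (Fin d) ℝ) (w₀ : Vec d) : ℕ → Vec d
  | 0 => w₀
  | t + 1 => app (1 + η • B t) (sgdIter η B w₀ t)

/-- The whole algorithm on the stream `B`: initialize with the first `T₀` samples, starting from
the vector `w`, run SGD with step size `η` on the next `T` samples, and normalize. -/
def output {d : ℕ} (T₀ T : ℕ) (η : ℝ) (B : ℕ → Matrix (Fin d) (Fin d) ℝ) (w : Vec d) : Vec d :=
  unitize (sgdIter η (fun t => B (T₀ + t)) (powerInit T₀ B w) T)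

/-- The relative suboptimality `1 - (xᵀ A x) / ‖A‖`. -/
def subopt {d : ℕ} (A : Matrix (Fin d) (Fin d) ℝ) (x : Vec d) : ℝ :=
  1 - inner ℝ x (app A x) / ‖A‖

/-- The event `1 / ⟨v, w₀⟩² ≤ p` for the initial point `w₀` (with `⟨v, w₀⟩ ≠ 0`). -/
def goodInit {d : ℕ} {Ω : Type*} (T₀ : ℕ) (B : ℕ → Ω → Matrix (Fin d) (Fin d) ℝ)
    (w : Ω → Vec d) (v : Vec d) (p : ℝ) : Set Ω :=
  {ω | inner ℝ v (powerInit T₀ (fun t => B t ω) (w ω)) ≠ 0 ∧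
    1 / (inner ℝ v (powerInit T₀ (fun t => B t ω) (w ω))) ^ 2 ≤ p}

/-- The event that the algorithm returns a unit vector whose relative suboptimality is at most
`ε`. -/
def success {d : ℕ} {Ω : Type*} (A : Matrix (Fin d) (Fin d) ℝ) (T₀ T : ℕ) (η : ℝ)
    (B : ℕ → Ω → Matrix (Fin d) (Fin d) ℝ) (w : Ω → Vec d) (ε : ℝ) : Set Ω :=
  {ω | ‖output T₀ T η (fun t => B t ω) (w ω)‖ = 1 ∧
    subopt A (output T₀ T η (fun t => B t ω) (w ω)) ≤ ε}

end StreamPCA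

end

open StreamPCA

/-! Rescale to `S = A / ‖A‖`, `X = B / ‖A‖`, `h = η‖A‖ = 1 / (b√(pT))`. With eigenpairs `(u i, s i)`
of `S`, set V(x) = ∑ (1 - ε - s i)⟨u i, x⟩². A negative V(w_T) says exactly that w_T ≠ 0 and that
its normalization has suboptimality below ε, so one has to bound P(V(w_T) < 0) from below on the
good event G. Let N = (1 + h)^(2T).

The mean of V(w_T) over G is very negative. One step maps the coefficients c of a quadratic form to
c i (1 + h s i)² plus a noise term h²b² max c, the part linear in the noise having mean zero
(`integral_quadForm_le`). With k steps left, the gap terms (1 + h s)^(2k) (1 - ε - s) are at most (1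
+ h)^(2k) · 2/(h(k+1)) (`pow_mul_gap_le`), so the accumulated noise is a harmonic sum, of order h b²
log T · N, comparable to Nε/p (`setIntegral_quadForm_le`, `potCoeff_le`). The leading eigenspace
contributes -Nε⟨v, w₀⟩² ≤ -Nε/p on G and wins by a factor two: the mean is at most -Nε/(2p) · P(G).

A negative mean could come from a rare huge ‖w_T‖. But -V ≤ ε‖w_T‖², and Hoeffding's lemma bounds
the moment of order 2n of ‖w_T‖, with n about p, by N^n e^(5n) P(G) (`setIntegral_norm_pow_le`);
here h²b²T = 1/p is decisive. The part of ‖w_T‖²/N above e^7 therefore contributes at most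
P(G)/(4p), and what remains forces P(G ∩ {V < 0}) ≥ P(G)/(4e^7 p) (`measure_potential_neg_ge`).

For the good start only second moments are needed: averaging over the Gaussian turns E‖(Ã - A)w‖²
into a Frobenius error, at most d b²‖A‖²/T₀, and Markov's inequality applies (`goodInit_prob_ge`).
-/

namespace StreamPCA

/-! ### Matrix-vector products and measurability -/

variable {d : ℕ}

lemma app_apply (M : Matrix (Fin d) (Fin d) ℝ) (x : Vec d) (i : Fin d) :
    app M x i = ∑ j, M i j * x j := by
  simp [app, Matrix.ofLp_toEuclideanCLM, Matrix.mulVec, dotProduct]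

lemma app_add_left (M N : Matrix (Fin d) (Fin d) ℝ) (x : Vec d) :
    app (M + N) x = app M x + app N x := by
  simp [app]

lemma app_sub_left (M N : Matrix (Fin d) (Fin d) ℝ) (x : Vec d) :
    app (M - N) x = app M x - app N x := by
  simp [app]

lemma app_smul_left (r : ℝ) (M : Matrix (Fin d) (Fin d) ℝ) (x : Vec d) :
    app (r • M) x = r • app M x := by
  simp [app]

lemma app_one (x : Vec d) : app 1 x = x := by
  simp [app]

lemma norm_app_le (M : Matrix (Fin d) (Fin d) ℝ) (x : Vec d) : ‖app M x‖ ≤ ‖M‖ * ‖x‖ := by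
  rw [Matrix.cstar_norm_def]
  exact ContinuousLinearMap.le_opNorm _ _

lemma inner_app_right (M : Matrix (Fin d) (Fin d) ℝ) (x y : Vec d) :
    inner ℝ x (app M y) = ∑ i, ∑ j, x i * y j * M i j := by
  simp only [PiLp.inner_apply, app_apply, RCLike.inner_apply, conj_trivial, Finset.sum_mul]
  exact Finset.sum_congr rfl fun i _ => Finset.sum_congr rfl fun j _ => by ring

lemma inner_app_comm {M : Matrix (Fin d) (Fin d) ℝ} (hM : M.IsHermitian) (x y : Vec d) :
    inner ℝ x (app M y) = inner ℝ (app M x) y := by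
  rw [real_inner_comm, real_inner_comm, real_inner_comm y, inner_app_right, inner_app_right,
    Finset.sum_comm]
  refine Finset.sum_congr rfl fun i _ => Finset.sum_congr rfl fun j _ => ?_
  have := hM.apply i j
  simp only [star_trivial] at this
  rw [this]; ring

lemma measurable_matrix_entry (i j : Fin d) :
    Measurable fun M : Matrix (Fin d) (Fin d) ℝ => M i j :=
  (measurable_pi_apply j).comp (measurable_pi_apply i)

lemma measurable_matrix_of_entry {α : Type*} [MeasurableSpace α]
    {f : α → Matrix (Fin d) (Fin d) ℝ} (h : ∀ i j, Measurable fun a => f a i j) :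
    Measurable f :=
  measurable_pi_lambda _ fun i => measurable_pi_lambda _ fun j => h i j

lemma Measurable.app {α : Type*} [MeasurableSpace α] {f : α → Matrix (Fin d) (Fin d) ℝ}
    {g : α → Vec d} (hf : Measurable f) (hg : Measurable g) :
    Measurable fun a => app (f a) (g a) := by
  have : (fun a => StreamPCA.app (f a) (g a)) =
      fun a => WithLp.toLp 2 (fun i => ∑ j, f a i j * g a j) := by
    ext a i
    simp [app_apply]
  rw [this]
  refine (WithLp.measurable_toLp 2 _).comp (measurable_pi_lambda _ fun i => ?_)
  refine Finset.measurable_sum _ fun j _ => ?_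
  exact ((measurable_matrix_entry i j).comp hf).mul (by fun_prop)

lemma Measurable.matrix_add {α : Type*} [MeasurableSpace α]
    {f g : α → Matrix (Fin d) (Fin d) ℝ} (hf : Measurable f) (hg : Measurable g) :
    Measurable fun a => f a + g a :=
  measurable_matrix_of_entry fun i j => by
    exact ((measurable_matrix_entry i j).comp hf).add ((measurable_matrix_entry i j).comp hg)

lemma Measurable.matrix_smul {α : Type*} [MeasurableSpace α] (r : ℝ)
    {f : α → Matrix (Fin d) (Fin d) ℝ} (hf : Measurable f) :
    Measurable fun a => r • f a :=
  measurable_matrix_of_entry fun i j => by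
    simpa using ((measurable_matrix_entry i j).comp hf).const_mul r

lemma Measurable.matrix_sum {α ι : Type*} [MeasurableSpace α] (s : Finset ι)
    {f : ι → α → Matrix (Fin d) (Fin d) ℝ} (hf : ∀ i, Measurable (f i)) :
    Measurable fun a => ∑ i ∈ s, f i a :=
  measurable_matrix_of_entry fun i j => by
    simpa [Matrix.sum_apply] using
      Finset.measurable_sum s fun k _ => (measurable_matrix_entry i j).comp (hf k)

lemma Measurable.unitize {α : Type*} [MeasurableSpace α] {f : α → Vec d} (hf : Measurable f) :
    Measurable fun a => unitize (f a) := by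
  unfold StreamPCA.unitize
  fun_prop

lemma Measurable.powerInit {α : Type*} [MeasurableSpace α] (T₀ : ℕ)
    {f : ℕ → α → Matrix (Fin d) (Fin d) ℝ} {g : α → Vec d} (hf : ∀ i, Measurable (f i))
    (hg : Measurable g) : Measurable fun a => powerInit T₀ (fun t => f t a) (g a) :=
  Measurable.unitize (Measurable.app (Measurable.matrix_smul _ (Measurable.matrix_sum _ hf)) hg)

lemma Measurable.sgdIter {α : Type*} [MeasurableSpace α] (η : ℝ)
    {f : ℕ → α → Matrix (Fin d) (Fin d) ℝ} {g : α → Vec d} (hf : ∀ i, Measurable (f i))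
    (hg : Measurable g) (t : ℕ) : Measurable fun a => sgdIter η (fun t => f t a) (g a) t := by
  induction t with
  | zero => exact hg
  | succ t ih =>
    exact Measurable.app (Measurable.matrix_add measurable_const
      (Measurable.matrix_smul _ (hf t))) ih

lemma norm_unitize {x : Vec d} (hx : x ≠ 0) : ‖unitize x‖ = 1 := by
  rw [unitize, norm_smul, norm_inv, norm_norm, inv_mul_cancel₀ (norm_ne_zero_iff.2 hx)]

/-! ### The spectral decomposition of a positive semidefinite matrix -/

lemma exists_eigenbasis {A : Matrix (Fin d) (Fin d) ℝ} (hA : A.PosSemidef) :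
    ∃ (u : OrthonormalBasis (Fin d) ℝ (Vec d)) (s : Fin d → ℝ),
      (∀ i, app A (u i) = s i • u i) ∧ (∀ i, 0 ≤ s i) ∧ ∀ i, s i ≤ ‖A‖ := by
  refine ⟨hA.1.eigenvectorBasis, hA.1.eigenvalues, fun i => ?_, hA.eigenvalues_nonneg, fun i => ?_⟩
  · ext j
    simpa [app, Matrix.ofLp_toEuclideanCLM] using congrFun (hA.1.mulVec_eigenvectorBasis i) j
  · have h1 : app A (hA.1.eigenvectorBasis i) = hA.1.eigenvalues i • hA.1.eigenvectorBasis i := by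
      ext j
      simpa [app, Matrix.ofLp_toEuclideanCLM] using congrFun (hA.1.mulVec_eigenvectorBasis i) j
    have h2 := norm_app_le A (hA.1.eigenvectorBasis i)
    rw [h1, norm_smul] at h2
    simp only [OrthonormalBasis.norm_eq_one, mul_one] at h2
    exact (le_abs_self _).trans h2

lemma inner_eigenvector_app {A : Matrix (Fin d) (Fin d) ℝ} (hA : A.IsHermitian) {u : Vec d}
    {s : ℝ} (h : app A u = s • u) (x : Vec d) : inner ℝ u (app A x) = s * inner ℝ u x := by
  rw [inner_app_comm hA, h, real_inner_smul_left]

lemma norm_sq_eq_sum (u : OrthonormalBasis (Fin d) ℝ (Vec d)) (x : Vec d) :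
    ‖x‖ ^ 2 = ∑ i, inner ℝ (u i) x ^ 2 := by
  rw [← u.sum_sq_norm_inner_right x]
  simp

lemma inner_eq_sum (u : OrthonormalBasis (Fin d) ℝ (Vec d)) (x y : Vec d) :
    inner ℝ x y = ∑ i, inner ℝ (u i) x * inner ℝ (u i) y := by
  rw [← u.sum_inner_mul_inner x y]
  exact Finset.sum_congr rfl fun i _ => by rw [real_inner_comm x]

lemma exists_eigenvalue_eq_norm {A : Matrix (Fin d) (Fin d) ℝ} (hA : A.PosSemidef) (h0 : A ≠ 0)
    {u : OrthonormalBasis (Fin d) ℝ (Vec d)} {s : Fin d → ℝ}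
    (hu : ∀ i, app A (u i) = s i • u i) (hs0 : ∀ i, 0 ≤ s i) (hs : ∀ i, s i ≤ ‖A‖) :
    ∃ i, s i = ‖A‖ := by
  by_cases hd : Nonempty (Fin d)
  · obtain ⟨i, hi⟩ := Finite.exists_max s
    refine ⟨i, le_antisymm (hs i) ?_⟩
    rw [Matrix.cstar_norm_def]
    refine ContinuousLinearMap.opNorm_le_bound _ (hs0 i) fun x => ?_
    have : ‖app A x‖ ^ 2 ≤ (s i * ‖x‖) ^ 2 := by
      rw [norm_sq_eq_sum u, mul_pow, norm_sq_eq_sum u x, Finset.mul_sum]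
      refine Finset.sum_le_sum fun j _ => ?_
      rw [inner_eigenvector_app hA.1 (hu j), mul_pow]
      exact mul_le_mul_of_nonneg_right (pow_le_pow_left₀ (hs0 j) (hi j) 2) (sq_nonneg _)
    exact le_of_sq_le_sq this (mul_nonneg (hs0 i) (norm_nonneg _))
  · refine absurd ?_ h0
    ext i
    exact absurd ⟨i⟩ hd

/-- For a positive semidefinite matrix the largest eigenvalue is the spectral norm, so every leading
eigenvector has eigenvalue `‖A‖`. -/
lemma IsLeadingEigenvector.app_eq {A : Matrix (Fin d) (Fin d) ℝ} (hA : A.PosSemidef)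
    (h0 : A ≠ 0) {v : Vec d} (hv : IsLeadingEigenvector A v) : app A v = ‖A‖ • v := by
  obtain ⟨u, s, hu, hs0, hs⟩ := exists_eigenbasis hA
  obtain ⟨i, hi⟩ := exists_eigenvalue_eq_norm hA h0 hu hs0 hs
  obtain ⟨hv1, r, hr, hmax⟩ := hv
  have h1 : ‖A‖ ≤ r := hi ▸ hmax (s i) (u i) (by
    intro h; have := u.norm_eq_one i; rw [h] at this; simp at this) (hu i)
  have h2 : r ≤ ‖A‖ := by
    have := norm_app_le A v
    rw [hr, norm_smul, hv1, mul_one, mul_one] at this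
    exact (le_abs_self r).trans this
  rw [hr, le_antisymm h2 h1]

lemma exists_isLeadingEigenvector {A : Matrix (Fin d) (Fin d) ℝ} (hA : A.PosSemidef)
    (h0 : A ≠ 0) : ∃ v, IsLeadingEigenvector A v := by
  obtain ⟨u, s, hu, hs0, hs⟩ := exists_eigenbasis hA
  obtain ⟨i, hi⟩ := exists_eigenvalue_eq_norm hA h0 hu hs0 hs
  refine ⟨u i, u.norm_eq_one i, s i, hu i, fun r x hx hr => ?_⟩
  have := norm_app_le A x
  rw [hr, norm_smul] at this
  rw [hi]
  exact (le_abs_self r).trans (le_of_mul_le_mul_right this (norm_pos_iff.2 hx))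

/-! ### Independence of the past and the present sample -/

/-- The two hypotheses factor the joint law of the triple into a product of three; reassociating
that product gives the claim. -/
lemma _root_.ProbabilityTheory.IndepFun.prodMk_left_of_right {Ω α β γ : Type*}
    [MeasurableSpace Ω] [MeasurableSpace α] [MeasurableSpace β] [MeasurableSpace γ]
    {μ : Measure Ω} [IsProbabilityMeasure μ] {f : Ω → α} {g : Ω → β} {k : Ω → γ}
    (hf : Measurable f) (hg : Measurable g) (hk : Measurable k)
    (h : IndepFun f (fun ω => (g ω, k ω)) μ) (hgk : IndepFun g k μ) :
    IndepFun (fun ω => (f ω, g ω)) k μ := by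
  have hfg : IndepFun f g μ := h.comp measurable_id measurable_fst
  rw [indepFun_iff_map_prod_eq_prod_map_map hf.aemeasurable (hg.prodMk hk).aemeasurable] at h
  rw [indepFun_iff_map_prod_eq_prod_map_map hg.aemeasurable hk.aemeasurable] at hgk
  rw [indepFun_iff_map_prod_eq_prod_map_map hf.aemeasurable hg.aemeasurable] at hfg
  rw [indepFun_iff_map_prod_eq_prod_map_map (hf.prodMk hg).aemeasurable hk.aemeasurable, hfg]
  have : IsProbabilityMeasure (μ.map f) := Measure.isProbabilityMeasure_map hf.aemeasurable
  have : IsProbabilityMeasure (μ.map g) := Measure.isProbabilityMeasure_map hg.aemeasurable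
  have : IsProbabilityMeasure (μ.map k) := Measure.isProbabilityMeasure_map hk.aemeasurable
  rw [← (MeasureTheory.measurePreserving_prodAssoc (μ.map f) (μ.map g) (μ.map k)).symm.map_eq,
    ← hgk, ← h, Measure.map_map (by fun_prop) (by fun_prop)]
  rfl

/-- The stream `B` with all samples from time `n` on replaced by zero. -/
def truncate {α : Type*} [Zero α] (n : ℕ) (B : ℕ → α) : ℕ → α := fun i => if i < n then B i else 0

lemma truncate_of_lt {α : Type*} [Zero α] {n i : ℕ} (B : ℕ → α) (h : i < n) :
    truncate n B i = B i := if_pos h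

/-- The padded past is a function of finitely many samples, hence independent of sample `n`; the
start vector is independent of both together. Padding with zeros keeps the past in the type of
streams, so the algorithm can be evaluated on it. -/
lemma indepFun_truncate {Ω α : Type*} [MeasurableSpace Ω] {μ : Measure Ω}
    [IsProbabilityMeasure μ] [MeasurableSpace α] {w : Ω → α}
    {B : ℕ → Ω → Matrix (Fin d) (Fin d) ℝ} (hBm : ∀ t, Measurable (B t)) (hB : iIndepFun B μ)
    (hwm : Measurable w) (hw : IndepFun w (fun ω t => B t ω) μ) (n : ℕ) :
    IndepFun (fun ω => (w ω, truncate n fun t => B t ω)) (B n) μ := by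
  have hm : Measurable fun b : ℕ → Matrix (Fin d) (Fin d) ℝ => truncate n b := by
    refine measurable_pi_lambda _ fun i => ?_
    by_cases h : i < n
    · simpa [truncate, h] using measurable_pi_apply i
    · simp [truncate, h]
  refine IndepFun.prodMk_left_of_right hwm
    (hm.comp (measurable_pi_lambda _ hBm)) (hBm n) ?_ ?_
  · exact hw.comp (φ := id) (ψ := fun b => (truncate n b, b n)) measurable_id
      (hm.prodMk (measurable_pi_apply n))
  · have h := hB.indepFun_finset (Finset.range n) {n} (by simp) hBm
    have h1 : Measurable fun (b : Finset.range n → Matrix (Fin d) (Fin d) ℝ) (i : ℕ) =>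
        if hi : i ∈ Finset.range n then b ⟨i, hi⟩ else 0 := measurable_pi_lambda _ fun i => by
      by_cases hi : i ∈ Finset.range n
      · simpa only [hi, dite_true] using measurable_pi_apply _
      · simp only [hi, dite_false]; exact measurable_const
    have h2 : Measurable fun (b : ({n} : Finset ℕ) → Matrix (Fin d) (Fin d) ℝ) =>
        b ⟨n, by simp⟩ := measurable_pi_apply _
    have := h.comp h1 h2
    convert this using 1
    · ext ω i
      simp [truncate]
    · rfl

/-- Fubini on the product law, in place of conditioning on the past `Y`: a bound for each frozen `y`
integrates to a bound for the random one. -/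
lemma _root_.ProbabilityTheory.IndepFun.integral_le_integral {Ω E F : Type*}
    [MeasurableSpace Ω] [MeasurableSpace E] [MeasurableSpace F] {μ : Measure Ω}
    [IsProbabilityMeasure μ] {Y : Ω → E} {X : Ω → F} (h : IndepFun Y X μ) (hY : Measurable Y)
    (hX : Measurable X) {φ : E → F → ℝ} (hφ : Measurable (Function.uncurry φ)) {ψ : E → ℝ}
    (hψ : Measurable ψ) (hφi : Integrable (fun ω => φ (Y ω) (X ω)) μ)
    (hψi : Integrable (fun ω => ψ (Y ω)) μ) (hle : ∀ y, ∫ ω, φ y (X ω) ∂μ ≤ ψ y) :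
    ∫ ω, φ (Y ω) (X ω) ∂μ ≤ ∫ ω, ψ (Y ω) ∂μ := by
  rw [indepFun_iff_map_prod_eq_prod_map_map hY.aemeasurable hX.aemeasurable] at h
  have : IsProbabilityMeasure (μ.map Y) := Measure.isProbabilityMeasure_map hY.aemeasurable
  have : IsProbabilityMeasure (μ.map X) := Measure.isProbabilityMeasure_map hX.aemeasurable
  have h1 : ∫ ω, φ (Y ω) (X ω) ∂μ = ∫ z, Function.uncurry φ z ∂((μ.map Y).prod (μ.map X)) := by
    rw [← h, integral_map (by fun_prop) hφ.aestronglyMeasurable]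
    rfl
  have h2 : Integrable (Function.uncurry φ) ((μ.map Y).prod (μ.map X)) := by
    rw [← h, integrable_map_measure hφ.aestronglyMeasurable (by fun_prop)]
    exact hφi
  have h3 : ∫ ω, ψ (Y ω) ∂μ = ∫ y, ψ y ∂(μ.map Y) := by
    rw [integral_map hY.aemeasurable hψ.aestronglyMeasurable]
  rw [h1, h3, integral_prod _ h2]
  refine integral_mono h2.integral_prod_left ?_ fun y => ?_
  · rwa [integrable_map_measure hψ.aestronglyMeasurable hY.aemeasurable]
  · refine le_of_eq_of_le ?_ (hle y)
    rw [integral_map hX.aemeasurable]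
    · rfl
    · exact (hφ.comp measurable_prodMk_left).aestronglyMeasurable

/-- The quadratic form with coefficients `c` in the orthonormal basis `u`. -/
noncomputable def quadForm (u : OrthonormalBasis (Fin d) ℝ (Vec d)) (c : Fin d → ℝ) (x : Vec d) :
    ℝ := ∑ i, c i * inner ℝ (u i) x ^ 2

lemma quadForm_mono (u : OrthonormalBasis (Fin d) ℝ (Vec d)) {c c' : Fin d → ℝ}
    (h : ∀ i, c i ≤ c' i) (x : Vec d) : quadForm u c x ≤ quadForm u c' x :=
  Finset.sum_le_sum fun i _ => mul_le_mul_of_nonneg_right (h i) (sq_nonneg _)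

lemma quadForm_const (u : OrthonormalBasis (Fin d) ℝ (Vec d)) (m : ℝ) (x : Vec d) :
    quadForm u (fun _ => m) x = m * ‖x‖ ^ 2 := by
  rw [quadForm, norm_sq_eq_sum u, Finset.mul_sum]

lemma abs_quadForm_le (u : OrthonormalBasis (Fin d) ℝ (Vec d)) (c : Fin d → ℝ) (x : Vec d) :
    |quadForm u c x| ≤ (∑ i, |c i|) * ‖x‖ ^ 2 := by
  have h : ∀ i, |c i| ≤ ∑ j, |c j| := fun i =>
    Finset.single_le_sum (fun j _ => abs_nonneg (c j)) (Finset.mem_univ i)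
  rw [abs_le, ← neg_mul, ← quadForm_const u, ← quadForm_const u]
  exact ⟨quadForm_mono u (fun i => (abs_le.1 (h i)).1) x,
    quadForm_mono u (fun i => (abs_le.1 (h i)).2) x⟩

lemma measurable_quadForm (u : OrthonormalBasis (Fin d) ℝ (Vec d)) (c : Fin d → ℝ) :
    Measurable (quadForm u c) := by
  unfold quadForm
  fun_prop

lemma app_one_add_smul (h : ℝ) (M : Matrix (Fin d) (Fin d) ℝ) (x : Vec d) :
    app (1 + h • M) x = x + h • app M x := by
  rw [app_add_left, app_smul_left, app_one]

lemma norm_app_one_add_smul_le {h : ℝ} (hh : 0 ≤ h) {M : Matrix (Fin d) (Fin d) ℝ} {b : ℝ}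
    (hM : ‖M‖ ≤ b) (x : Vec d) : ‖app (1 + h • M) x‖ ≤ (1 + h * b) * ‖x‖ := by
  rw [app_one_add_smul, add_mul, one_mul, mul_assoc]
  refine (norm_add_le _ _).trans (add_le_add le_rfl ?_)
  rw [norm_smul, Real.norm_of_nonneg hh]
  refine mul_le_mul_of_nonneg_left ((norm_app_le M x).trans ?_) hh
  exact mul_le_mul_of_nonneg_right hM (norm_nonneg _)

/-! ### One SGD step: mean of a quadratic form and moments of the norm -/

section Step

variable {Ω : Type*} [MeasurableSpace Ω] {μ : Measure Ω}
  {S : Matrix (Fin d) (Fin d) ℝ} {X : Ω → Matrix (Fin d) (Fin d) ℝ} {b h : ℝ}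

lemma integrable_inner_app (hXi : ∀ i j, Integrable (fun ω => X ω i j) μ) (x y : Vec d) :
    Integrable (fun ω => inner ℝ x (app (X ω) y)) μ := by
  simp only [inner_app_right]
  exact integrable_finsetSum _ fun i _ => integrable_finsetSum _ fun j _ => (hXi i j).const_mul _

lemma integral_inner_app (hXi : ∀ i j, Integrable (fun ω => X ω i j) μ)
    (hXS : ∀ i j, ∫ ω, X ω i j ∂μ = S i j) (x y : Vec d) :
    ∫ ω, inner ℝ x (app (X ω) y) ∂μ = inner ℝ x (app S y) := by
  simp only [inner_app_right]
  rw [integral_finsetSum _ fun i _ => integrable_finsetSum _ fun j _ => (hXi i j).const_mul _]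
  refine Finset.sum_congr rfl fun i _ => ?_
  rw [integral_finsetSum _ fun j _ => (hXi i j).const_mul _]
  exact Finset.sum_congr rfl fun j _ => by rw [integral_const_mul, hXS]

variable [IsProbabilityMeasure μ]

lemma integrable_inner_app_sub (hXi : ∀ i j, Integrable (fun ω => X ω i j) μ) (x y : Vec d) :
    Integrable (fun ω => inner ℝ x (app (X ω - S) y)) μ := by
  simp only [app_sub_left, inner_sub_right]
  exact (integrable_inner_app hXi x y).sub (integrable_const _)

lemma integral_inner_app_sub (hXi : ∀ i j, Integrable (fun ω => X ω i j) μ)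
    (hXS : ∀ i j, ∫ ω, X ω i j ∂μ = S i j) (x y : Vec d) :
    ∫ ω, inner ℝ x (app (X ω - S) y) ∂μ = 0 := by
  simp only [app_sub_left, inner_sub_right]
  rw [integral_sub (integrable_inner_app hXi x y) (integrable_const _),
    integral_inner_app hXi hXS]
  simp

/-- Split `X = S + (X - S)`: the part linear in the noise has mean zero, and the part quadratic in
it is at most `m h² b² ‖x‖²`. Only an upper bound on the coefficients is needed; they may be
negative. -/
lemma integral_quadForm_le (hS : S.IsHermitian) {u : OrthonormalBasis (Fin d) ℝ (Vec d)}
    {s : Fin d → ℝ} (hu : ∀ i, app S (u i) = s i • u i)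
    (hXm : Measurable X) (hXi : ∀ i j, Integrable (fun ω => X ω i j) μ)
    (hXS : ∀ i j, ∫ ω, X ω i j ∂μ = S i j) (hh : 0 ≤ h)
    (hXb : ∀ᵐ ω ∂μ, ‖X ω‖ ≤ b ∧ ‖X ω - S‖ ≤ b)
    {c : Fin d → ℝ} {m : ℝ} (hm : 0 ≤ m) (hc : ∀ i, c i ≤ m) (x : Vec d) :
    ∫ ω, quadForm u c (app (1 + h • X ω) x) ∂μ ≤
      quadForm u (fun i => c i * (1 + h * s i) ^ 2 + h ^ 2 * b ^ 2 * m) x := by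
  set K := quadForm u (fun i => c i * (1 + h * s i) ^ 2 + h ^ 2 * b ^ 2 * m) x with hK
  let k : Fin d → ℝ := fun i => 2 * h * c i * (1 + h * s i) * inner ℝ (u i) x
  have hlin : Integrable (fun ω => ∑ i, k i * inner ℝ (u i) (app (X ω - S) x)) μ :=
    integrable_finsetSum _ fun i _ => (integrable_inner_app_sub hXi _ _).const_mul _
  have hint : ∫ ω, (K + ∑ i, k i * inner ℝ (u i) (app (X ω - S) x)) ∂μ = K := by
    rw [integral_add (integrable_const _) hlin, integral_finsetSum _ fun i _ =>
      (integrable_inner_app_sub hXi _ _).const_mul _]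
    simp [integral_const_mul, integral_inner_app_sub hXi hXS]
  have hmeas : Measurable fun ω => app (1 + h • X ω) x :=
    Measurable.app (Measurable.matrix_add measurable_const (Measurable.matrix_smul _ hXm))
      measurable_const
  rw [← hint]
  refine integral_mono_ae ?_ ((integrable_const _).add hlin) ?_
  · refine Integrable.of_bound ((measurable_quadForm u c).comp hmeas).aestronglyMeasurable
      ((∑ i, |c i|) * ((1 + h * b) * ‖x‖) ^ 2) ?_
    filter_upwards [hXb] with ω hω
    refine (abs_quadForm_le u c _).trans ?_
    gcongr
    exact norm_app_one_add_smul_le hh hω.1 x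
  · filter_upwards [hXb] with ω hω
    have h1 : ∀ i, inner ℝ (u i) (app (1 + h • X ω) x) =
        (1 + h * s i) * inner ℝ (u i) x + h * inner ℝ (u i) (app (X ω - S) x) := fun i => by
      rw [app_one_add_smul, app_sub_left, inner_add_right, inner_smul_right, inner_sub_right,
        inner_eigenvector_app hS (hu i)]
      ring
    have h2 : ‖app (X ω - S) x‖ ^ 2 ≤ b ^ 2 * ‖x‖ ^ 2 := by
      rw [← mul_pow]
      exact pow_le_pow_left₀ (norm_nonneg _) ((norm_app_le _ _).trans
        (mul_le_mul_of_nonneg_right hω.2 (norm_nonneg _))) 2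
    have h3 : ∑ i, c i * inner ℝ (u i) (app (X ω - S) x) ^ 2 ≤ m * (b ^ 2 * ‖x‖ ^ 2) := by
      refine (quadForm_mono u hc _).trans ?_
      rw [quadForm_const]
      exact mul_le_mul_of_nonneg_left h2 hm
    have h4 : K = ∑ i, c i * (1 + h * s i) ^ 2 * inner ℝ (u i) x ^ 2
        + h ^ 2 * (m * (b ^ 2 * ‖x‖ ^ 2)) := by
      rw [hK, quadForm, norm_sq_eq_sum u, Finset.mul_sum, Finset.mul_sum, Finset.mul_sum,
        ← Finset.sum_add_distrib]
      exact Finset.sum_congr rfl fun i _ => by ring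
    have h5 : quadForm u c (app (1 + h • X ω) x) =
        ∑ i, c i * (1 + h * s i) ^ 2 * inner ℝ (u i) x ^ 2
          + h ^ 2 * ∑ i, c i * inner ℝ (u i) (app (X ω - S) x) ^ 2
          + ∑ i, k i * inner ℝ (u i) (app (X ω - S) x) := by
      rw [quadForm, Finset.mul_sum, ← Finset.sum_add_distrib, ← Finset.sum_add_distrib]
      exact Finset.sum_congr rfl fun i _ => by rw [h1]; simp only [k]; ring
    rw [h5, h4]
    gcongr

/-- The relative growth of `‖x‖²` beyond `(1 + h)²` is at most `exp ((h b)² + Z)` with `Z` centred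
and of size at most `2 h b`. Hoeffding's lemma for `exp (n Z)` yields the term `2 n² (h b)²`. -/
lemma integral_norm_pow_le (hS1 : ‖S‖ ≤ 1)
    (hXi : ∀ i j, Integrable (fun ω => X ω i j) μ)
    (hXS : ∀ i j, ∫ ω, X ω i j ∂μ = S i j) (hh : 0 ≤ h)
    (hXb : ∀ᵐ ω ∂μ, ‖X ω‖ ≤ b ∧ ‖X ω - S‖ ≤ b) {n : ℕ} (hn : n ≠ 0) (x : Vec d) :
    ∫ ω, ‖app (1 + h • X ω) x‖ ^ (2 * n) ∂μ ≤
      (1 + h) ^ (2 * n) * Real.exp (n * (h * b) ^ 2 + 2 * n ^ 2 * (h * b) ^ 2)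
        * ‖x‖ ^ (2 * n) := by
  rcases eq_or_ne x 0 with rfl | hx
  · simp [app, hn]
  have hx0 : 0 < ‖x‖ := norm_pos_iff.2 hx
  set r : ℝ := 2 * h / ((1 + h) ^ 2 * ‖x‖ ^ 2) with hr
  have hr0 : 0 ≤ r := by positivity
  set Z : Ω → ℝ := fun ω => r * inner ℝ x (app (X ω - S) x) with hZ
  have hZm : AEMeasurable Z μ :=
    (integrable_inner_app_sub hXi x x).aestronglyMeasurable.aemeasurable.const_mul r
  have hinner : ∀ᵐ ω ∂μ, |inner ℝ x (app (X ω - S) x)| ≤ b * ‖x‖ ^ 2 := by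
    filter_upwards [hXb] with ω hω
    refine (abs_real_inner_le_norm _ _).trans ?_
    calc ‖x‖ * ‖app (X ω - S) x‖ ≤ ‖x‖ * (b * ‖x‖) := by
          gcongr
          exact (norm_app_le _ _).trans (mul_le_mul_of_nonneg_right hω.2 (norm_nonneg _))
      _ = _ := by ring
  have hb : 0 ≤ b := by
    obtain ⟨ω, hω⟩ := hXb.exists
    exact (norm_nonneg _).trans hω.1
  have hZb : ∀ᵐ ω ∂μ, Z ω ∈ Set.Icc (-(2 * (h * b))) (2 * (h * b)) := by
    filter_upwards [hinner] with ω hω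
    rw [Set.mem_Icc, ← abs_le]
    simp only [hZ, abs_mul, abs_of_nonneg hr0]
    calc r * |inner ℝ x (app (X ω - S) x)| ≤ r * (b * ‖x‖ ^ 2) := by gcongr
      _ = 2 * (h * b) / (1 + h) ^ 2 := by rw [hr]; field_simp
      _ ≤ 2 * (h * b) := div_le_self (by positivity) (one_le_pow₀ (by linarith))
  have hZ0 : ∫ ω, Z ω ∂μ = 0 := by
    rw [hZ, integral_const_mul, integral_inner_app_sub hXi hXS, mul_zero]
  have hmgf := hasSubgaussianMGF_of_mem_Icc_of_integral_eq_zero hZm hZb hZ0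
  have hexp := hmgf.mgf_le n
  have hpt : ∀ᵐ ω ∂μ, ‖app (1 + h • X ω) x‖ ^ (2 * n) ≤
      (1 + h) ^ (2 * n) * Real.exp (n * (h * b) ^ 2) * ‖x‖ ^ (2 * n) * Real.exp (n * Z ω) := by
    filter_upwards [hXb] with ω hω
    have h1 : ‖app (X ω) x‖ ^ 2 ≤ b ^ 2 * ‖x‖ ^ 2 := by
      rw [← mul_pow]
      exact pow_le_pow_left₀ (norm_nonneg _) ((norm_app_le _ _).trans
        (mul_le_mul_of_nonneg_right hω.1 (norm_nonneg _))) 2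
    have h2 : inner ℝ x (app S x) ≤ ‖x‖ ^ 2 := by
      refine (real_inner_le_norm _ _).trans ?_
      rw [sq]
      gcongr
      exact (norm_app_le _ _).trans (mul_le_of_le_one_left (norm_nonneg _) hS1)
    have h3 : inner ℝ x (app (X ω) x) = inner ℝ x (app S x) + inner ℝ x (app (X ω - S) x) := by
      rw [app_sub_left, inner_sub_right]; ring
    have h4 : (1 + h) ^ 2 * ‖x‖ ^ 2 * Z ω = 2 * h * inner ℝ x (app (X ω - S) x) := by
      simp only [hZ, hr]
      field_simp
    have h5 : ‖app (1 + h • X ω) x‖ ^ 2 ≤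
        (1 + h) ^ 2 * ‖x‖ ^ 2 * (1 + ((h * b) ^ 2 + Z ω)) := by
      rw [app_one_add_smul, norm_add_sq_real, norm_smul, real_inner_smul_right, mul_pow,
        Real.norm_eq_abs, sq_abs, h3]
      have h6 : (h * b) ^ 2 * ‖x‖ ^ 2 ≤ (1 + h) ^ 2 * ‖x‖ ^ 2 * (h * b) ^ 2 := by
        have : 1 ≤ (1 + h) ^ 2 := one_le_pow₀ (by linarith)
        nlinarith [mul_nonneg (sq_nonneg (h * b)) (sq_nonneg ‖x‖)]
      nlinarith [mul_le_mul_of_nonneg_left h1 (sq_nonneg h), mul_le_mul_of_nonneg_left h2 hh,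
        mul_nonneg (sq_nonneg h) (sq_nonneg ‖x‖)]
    have h7 : ‖app (1 + h • X ω) x‖ ^ 2 ≤
        (1 + h) ^ 2 * ‖x‖ ^ 2 * Real.exp ((h * b) ^ 2 + Z ω) := by
      refine h5.trans (mul_le_mul_of_nonneg_left ?_ (by positivity))
      linarith [Real.add_one_le_exp ((h * b) ^ 2 + Z ω)]
    calc ‖app (1 + h • X ω) x‖ ^ (2 * n) = (‖app (1 + h • X ω) x‖ ^ 2) ^ n := by rw [pow_mul]
      _ ≤ ((1 + h) ^ 2 * ‖x‖ ^ 2 * Real.exp ((h * b) ^ 2 + Z ω)) ^ n :=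
        pow_le_pow_left₀ (by positivity) h7 n
      _ = _ := by
        rw [mul_pow, mul_pow, ← pow_mul, ← pow_mul, ← Real.exp_nat_mul, mul_add, Real.exp_add]
        ring
  calc ∫ ω, ‖app (1 + h • X ω) x‖ ^ (2 * n) ∂μ
      ≤ ∫ ω, (1 + h) ^ (2 * n) * Real.exp (n * (h * b) ^ 2) * ‖x‖ ^ (2 * n)
          * Real.exp (n * Z ω) ∂μ := by
        refine integral_mono_of_nonneg (.of_forall fun ω => by positivity)
          ((hmgf.integrable_exp_mul n).const_mul _) hpt
    _ = (1 + h) ^ (2 * n) * Real.exp (n * (h * b) ^ 2) * ‖x‖ ^ (2 * n) * mgf Z μ n := by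
        rw [integral_const_mul]; rfl
    _ ≤ (1 + h) ^ (2 * n) * Real.exp (n * (h * b) ^ 2) * ‖x‖ ^ (2 * n)
          * Real.exp (2 * n ^ 2 * (h * b) ^ 2) := by
        gcongr
        refine hexp.trans (Real.exp_le_exp.2 (le_of_eq ?_))
        have hhb : (0 : ℝ) ≤ h * b := by positivity
        push_cast
        rw [Real.norm_of_nonneg (by linarith)]
        ring
    _ = _ := by rw [Real.exp_add]; ring

end Step

/-! ### Scalar estimates -/

/-- With `u = 1 - s`, `(1 + h s)² (1 + h u) ≤ (1 + h)²`; Bernoulli then makes the left side at most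
`(1 + h)^(2k) u / (1 + k h u)`. A small gap is small itself, a large gap is damped. -/
lemma pow_mul_gap_le {h s ε : ℝ} (hh : 0 < h) (hh1 : h ≤ 1) (hs0 : 0 ≤ s) (hs1 : s ≤ 1)
    (hε : 0 ≤ ε) (k : ℕ) :
    (1 + h * s) ^ (2 * k) * (1 - ε - s) ≤ (1 + h) ^ (2 * k) * (2 / (h * (k + 1))) := by
  set u := 1 - s with hu
  have hu0 : 0 ≤ u := by linarith
  have hu1 : u ≤ 1 := by linarith
  have h1 : (1 + h * s) ^ 2 * (1 + h * u) ≤ (1 + h) ^ 2 := by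
    have hs : s = 1 - u := by linarith
    rw [hs]
    have e : (1 + h) ^ 2 - (1 + h * (1 - u)) ^ 2 * (1 + h * u)
        = h * u * (1 - h ^ 2) + h ^ 2 * u ^ 2 * (1 + h * (1 - u) + h) := by ring
    have : 0 ≤ h * u * (1 - h ^ 2) + h ^ 2 * u ^ 2 * (1 + h * (1 - u) + h) := by
      have : 0 ≤ 1 - h ^ 2 := by nlinarith
      have : 0 ≤ 1 - u := by linarith
      positivity
    linarith
  have h2 : (1 + h * s) ^ (2 * k) * (1 + k * (h * u)) ≤ (1 + h) ^ (2 * k) := by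
    have hb := one_add_mul_le_pow (a := h * u) (by nlinarith [mul_nonneg hh.le hu0]) k
    calc (1 + h * s) ^ (2 * k) * (1 + k * (h * u))
        ≤ (1 + h * s) ^ (2 * k) * (1 + h * u) ^ k := by gcongr
      _ = ((1 + h * s) ^ 2 * (1 + h * u)) ^ k := by rw [mul_pow, pow_mul]
      _ ≤ ((1 + h) ^ 2) ^ k := pow_le_pow_left₀ (by positivity) h1 k
      _ = _ := by rw [pow_mul]
  have h3 : u ≤ (1 + k * (h * u)) * (2 / (h * (k + 1))) := by
    rw [mul_div_assoc', le_div_iff₀ (by positivity)]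
    have : h * u ≤ 1 := by nlinarith
    have : 0 ≤ (k : ℝ) * (h * u) := by positivity
    nlinarith
  calc (1 + h * s) ^ (2 * k) * (1 - ε - s) ≤ (1 + h * s) ^ (2 * k) * u := by gcongr; linarith
    _ ≤ (1 + h * s) ^ (2 * k) * ((1 + k * (h * u)) * (2 / (h * (k + 1)))) := by gcongr
    _ ≤ _ := by rw [← mul_assoc]; gcongr

/-- Only `s < 1 - ε` matters, and there each factor `1 + h s` loses `exp (-(h ε / 2))` against `1 +
h`. This bound serves for the full horizon, where `h ε T` is large. -/
lemma pow_mul_gap_le_exp {h s ε : ℝ} (hh : 0 < h) (hh1 : h ≤ 1) (hs0 : 0 ≤ s)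
    (hε : 0 ≤ ε) (k : ℕ) :
    (1 + h * s) ^ (2 * k) * (1 - ε - s) ≤ (1 + h) ^ (2 * k) * Real.exp (-(h * ε * k)) := by
  by_cases hs : 1 - ε - s ≤ 0
  · exact (mul_nonpos_of_nonneg_of_nonpos (by positivity) hs).trans (by positivity)
  · push Not at hs
    have h1 : 1 + h * s ≤ (1 + h) * Real.exp (-(h * ε / 2)) := by
      have := Real.add_one_le_exp (-(h * ε / 2))
      refine le_trans ?_ (mul_le_mul_of_nonneg_left this (by positivity))
      nlinarith [mul_nonneg hh.le hε, mul_pos hh hs]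
    calc (1 + h * s) ^ (2 * k) * (1 - ε - s) ≤ (1 + h * s) ^ (2 * k) * 1 := by
          gcongr; linarith
      _ ≤ ((1 + h) * Real.exp (-(h * ε / 2))) ^ (2 * k) * 1 := by gcongr
      _ = _ := by
        rw [mul_one, mul_pow, ← Real.exp_nat_mul]
        congr 2
        push_cast; ring

lemma sum_range_inv_le (T : ℕ) : ∑ j ∈ Finset.range T, 1 / ((j : ℝ) + 1) ≤ 1 + Real.log T := by
  have := harmonic_le_one_add_log T
  simpa [harmonic] using this

lemma exp_moment_le {n : ℕ} (hn : 8 ≤ n) : Real.exp (7 - 2 * n) ≤ 1 / (4 * n) := by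
  have hn' : (8 : ℝ) ≤ n := by exact_mod_cast hn
  have h := Real.quadratic_le_exp_of_nonneg (x := 2 * n - 7) (by linarith)
  rw [show (7 - 2 * n : ℝ) = -(2 * n - 7) by ring, Real.exp_neg, ← one_div]
  refine one_div_le_one_div_of_le (by linarith) (le_trans ?_ h)
  nlinarith

/-- Coefficients of the quadratic form bounding `k` steps of the expected potential. -/
noncomputable def potCoeff (h b ε : ℝ) (s : Fin d → ℝ) (k : ℕ) (i : Fin d) : ℝ :=
  (1 + h * s i) ^ (2 * k) * (1 - ε - s i) +
    2 * h * b ^ 2 * (∑ j ∈ Finset.range k, 1 / ((j : ℝ) + 1)) *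
      ((1 + h) ^ 2 + h ^ 2 * b ^ 2) ^ k

/-! ### Expected potential and moments along the iteration -/

section SGD

variable {Ω : Type*} [MeasurableSpace Ω] {μ : Measure Ω}
  {S : Matrix (Fin d) (Fin d) ℝ} {X : ℕ → Ω → Matrix (Fin d) (Fin d) ℝ} {b h : ℝ}
  {x : ℕ → Ω → Vec d} {G : Set Ω}

/-- A crude almost sure growth bound, used only for integrability. -/
lemma ae_norm_iterate_le (hh : 0 ≤ h)
    (hXb : ∀ t, ∀ᵐ ω ∂μ, ‖X t ω‖ ≤ b ∧ ‖X t ω - S‖ ≤ b)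
    (hx : ∀ t ω, x (t + 1) ω = app (1 + h • X t ω) (x t ω)) (hG : ∀ ω ∈ G, ‖x 0 ω‖ = 1) (t : ℕ) :
    ∀ᵐ ω ∂μ, ω ∈ G → ‖x t ω‖ ≤ (1 + h * b) ^ t := by
  induction t with
  | zero => exact .of_forall fun ω hω => by simp [hG ω hω]
  | succ t ih =>
    filter_upwards [ih, hXb t] with ω h1 h2 hω
    have hb : 0 ≤ b := (norm_nonneg _).trans h2.1
    rw [hx, pow_succ, mul_comm]
    exact (norm_app_one_add_smul_le hh h2.1 _).trans
      (mul_le_mul_of_nonneg_left (h1 hω) (by positivity))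

variable [IsProbabilityMeasure μ]

lemma integrableOn_iterate (hh : 0 ≤ h)
    (hXb : ∀ t, ∀ᵐ ω ∂μ, ‖X t ω‖ ≤ b ∧ ‖X t ω - S‖ ≤ b)
    (hxm : ∀ t, Measurable (x t))
    (hx : ∀ t ω, x (t + 1) ω = app (1 + h • X t ω) (x t ω)) (hGm : MeasurableSet G)
    (hG : ∀ ω ∈ G, ‖x 0 ω‖ = 1) {f : Vec d → ℝ} (hf : Measurable f) {C : ℝ} {n : ℕ}
    (hfC : ∀ y, |f y| ≤ C * ‖y‖ ^ n) (t : ℕ) : IntegrableOn (fun ω => f (x t ω)) G μ := by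
  refine Integrable.of_bound (hf.comp (hxm t)).aestronglyMeasurable (|C| * ((1 + h * b) ^ t) ^ n) ?_
  rw [ae_restrict_iff' hGm]
  filter_upwards [ae_norm_iterate_le hh hXb hx hG t] with ω hω hωG
  refine (hfC _).trans ?_
  gcongr
  · exact le_abs_self C
  · exact hω hωG

/-- The indicator of the good event is carried along with the state, so that a one-step bound for
fixed vectors transfers to integrals over `G`. -/
lemma setIntegral_iterate_succ_le (hXm : ∀ t, Measurable (X t)) (hh : 0 ≤ h)
    (hXb : ∀ t, ∀ᵐ ω ∂μ, ‖X t ω‖ ≤ b ∧ ‖X t ω - S‖ ≤ b)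
    (hxm : ∀ t, Measurable (x t))
    (hx : ∀ t ω, x (t + 1) ω = app (1 + h • X t ω) (x t ω)) (hGm : MeasurableSet G)
    (hG : ∀ ω ∈ G, ‖x 0 ω‖ = 1)
    (hind : ∀ t, IndepFun (fun ω => (x t ω, G.indicator (fun _ => (1 : ℝ)) ω)) (X t) μ)
    {f g : Vec d → ℝ} (hf : Measurable f) (hg : Measurable g) {C C' : ℝ} {n n' : ℕ}
    (hfC : ∀ y, |f y| ≤ C * ‖y‖ ^ n) (hgC : ∀ y, |g y| ≤ C' * ‖y‖ ^ n') {t : ℕ}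
    (hfg : ∀ y, ∫ ω, f (app (1 + h • X t ω) y) ∂μ ≤ g y) :
    ∫ ω in G, f (x (t + 1) ω) ∂μ ≤ ∫ ω in G, g (x t ω) ∂μ := by
  -- The indicator is squared because the one-step bound is required for every real value of the
  -- second coordinate, and the weight must be nonnegative.
  have e : ∀ (f : Vec d → ℝ) (t : ℕ), G.indicator (fun ω => f (x t ω)) =
      fun ω => G.indicator (fun _ => (1 : ℝ)) ω ^ 2 * f (x t ω) := fun f t => by
    ext ω
    by_cases hω : ω ∈ G <;> simp [hω]
  have hfi := (integrableOn_iterate hh hXb hxm hx hGm hG hf hfC (t + 1)).integrable_indicator hGm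
  have hgi := (integrableOn_iterate hh hXb hxm hx hGm hG hg hgC t).integrable_indicator hGm
  rw [← integral_indicator hGm, ← integral_indicator hGm]
  rw [e] at hfi hgi ⊢
  rw [e]
  simp only [hx] at hfi ⊢
  refine (hind t).integral_le_integral (φ := fun y M => y.2 ^ 2 * f (app (1 + h • M) y.1))
    (ψ := fun y => y.2 ^ 2 * g y.1) ((hxm t).prodMk (measurable_const.indicator hGm)) (hXm t)
    ?_ ?_ hfi hgi ?_
  · refine Measurable.mul (by fun_prop) (hf.comp (Measurable.app (Measurable.matrix_add
      measurable_const (Measurable.matrix_smul _ measurable_snd)) (by fun_prop)))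
  · exact Measurable.mul (by fun_prop) (hg.comp measurable_fst)
  · rintro ⟨y, γ⟩
    rw [integral_const_mul]
    exact mul_le_mul_of_nonneg_left (hfg y) (sq_nonneg _)

/-- Induction on the number `k` of remaining steps, for all `t` at once: the form for `k` steps at
time `t + 1` is pulled back through one step to time `t`. -/
lemma setIntegral_quadForm_le (hS : S.IsHermitian) {u : OrthonormalBasis (Fin d) ℝ (Vec d)}
    {s : Fin d → ℝ} (hu : ∀ i, app S (u i) = s i • u i) (hs0 : ∀ i, 0 ≤ s i) (hs1 : ∀ i, s i ≤ 1)
    (hXm : ∀ t, Measurable (X t)) (hXi : ∀ t i j, Integrable (fun ω => X t ω i j) μ)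
    (hXS : ∀ t i j, ∫ ω, X t ω i j ∂μ = S i j) (hh : 0 < h) (hh1 : h ≤ 1)
    (hXb : ∀ t, ∀ᵐ ω ∂μ, ‖X t ω‖ ≤ b ∧ ‖X t ω - S‖ ≤ b)
    (hxm : ∀ t, Measurable (x t))
    (hx : ∀ t ω, x (t + 1) ω = app (1 + h • X t ω) (x t ω)) (hGm : MeasurableSet G)
    (hG : ∀ ω ∈ G, ‖x 0 ω‖ = 1)
    (hind : ∀ t, IndepFun (fun ω => (x t ω, G.indicator (fun _ => (1 : ℝ)) ω)) (X t) μ)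
    {ε : ℝ} (hε : 0 ≤ ε) (k t : ℕ) :
    ∫ ω in G, quadForm u (fun i => 1 - ε - s i) (x (t + k) ω) ∂μ ≤
      ∫ ω in G, quadForm u (potCoeff h b ε s k) (x t ω) ∂μ := by
  induction k generalizing t with
  | zero =>
    have : potCoeff h b ε s 0 = fun i => 1 - ε - s i := by
      ext i; simp [potCoeff]
    rw [this, add_zero]
  | succ k ih =>
    rw [show t + (k + 1) = t + 1 + k by ring]
    refine (ih (t + 1)).trans ?_
    refine setIntegral_iterate_succ_le hXm hh.le hXb hxm hx hGm hG hind
      (measurable_quadForm _ _) (measurable_quadForm _ _) (abs_quadForm_le _ _)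
      (abs_quadForm_le _ _) fun y => ?_
    set ρ : ℝ := (1 + h) ^ 2 + h ^ 2 * b ^ 2 with hρ
    set H : ℝ := ∑ j ∈ Finset.range k, 1 / ((j : ℝ) + 1) with hH
    have hH0 : 0 ≤ H := Finset.sum_nonneg fun j _ => by positivity
    have hρ1 : 1 ≤ ρ := by
      have : 1 ≤ (1 + h) ^ 2 := one_le_pow₀ (by linarith)
      nlinarith [mul_nonneg (sq_nonneg h) (sq_nonneg b)]
    -- A uniform bound for all coefficients at level `k`. Multiplied by `h² b²`, its first part is
    -- the next harmonic term and its second part is absorbed by raising the power of `ρ`.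
    set m : ℝ := (1 + h) ^ (2 * k) * (2 / (h * (k + 1))) + 2 * h * b ^ 2 * H * ρ ^ k with hm
    refine (integral_quadForm_le hS hu (hXm t) (hXi t) (hXS t) hh.le (hXb t)
      (m := m) (by positivity) (fun i => ?_) y).trans (quadForm_mono u (fun i => ?_) y)
    · rw [potCoeff]
      exact add_le_add_left (pow_mul_gap_le hh hh1 (hs0 i) (hs1 i) hε k) _
    · rw [potCoeff, potCoeff, Finset.sum_range_succ, ← hH, ← hρ]
      have h1 : (1 + h * s i) ^ 2 ≤ (1 + h) ^ 2 := by
        have := hs0 i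
        have := hs1 i
        gcongr
        nlinarith
      have h2 : (1 + h) ^ (2 * k) ≤ ρ ^ (k + 1) := by
        rw [pow_mul]
        refine (pow_le_pow_left₀ (by positivity) (?_ : (1 + h) ^ 2 ≤ ρ) k).trans
          (pow_le_pow_right₀ hρ1 (by omega))
        rw [hρ]
        nlinarith [mul_nonneg (sq_nonneg h) (sq_nonneg b)]
      have h3 : h ^ 2 * b ^ 2 * ((1 + h) ^ (2 * k) * (2 / (h * (k + 1)))) ≤
          2 * h * b ^ 2 * (1 / ((k : ℝ) + 1)) * ρ ^ (k + 1) := by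
        calc h ^ 2 * b ^ 2 * ((1 + h) ^ (2 * k) * (2 / (h * (k + 1))))
            = 2 * h * b ^ 2 * (1 / ((k : ℝ) + 1)) * (1 + h) ^ (2 * k) := by
              field_simp
          _ ≤ _ := by gcongr
      have h4 : 2 * h * b ^ 2 * H * ρ ^ k * (1 + h * s i) ^ 2 ≤
          2 * h * b ^ 2 * H * ρ ^ k * (1 + h) ^ 2 := by gcongr
      have h5 : 2 * h * b ^ 2 * H * ρ ^ (k + 1) = 2 * h * b ^ 2 * H * ρ ^ k * (1 + h) ^ 2
          + h ^ 2 * b ^ 2 * (2 * h * b ^ 2 * H * ρ ^ k) := by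
        rw [pow_succ, hρ]; ring
      have h6 : (1 + h * s i) ^ (2 * (k + 1)) = (1 + h * s i) ^ (2 * k) * (1 + h * s i) ^ 2 := by
        ring
      rw [h6, hm]
      linarith

lemma setIntegral_norm_pow_le (hS1 : ‖S‖ ≤ 1)
    (hXm : ∀ t, Measurable (X t)) (hXi : ∀ t i j, Integrable (fun ω => X t ω i j) μ)
    (hXS : ∀ t i j, ∫ ω, X t ω i j ∂μ = S i j) (hh : 0 ≤ h)
    (hXb : ∀ t, ∀ᵐ ω ∂μ, ‖X t ω‖ ≤ b ∧ ‖X t ω - S‖ ≤ b)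
    (hxm : ∀ t, Measurable (x t))
    (hx : ∀ t ω, x (t + 1) ω = app (1 + h • X t ω) (x t ω)) (hGm : MeasurableSet G)
    (hG : ∀ ω ∈ G, ‖x 0 ω‖ = 1)
    (hind : ∀ t, IndepFun (fun ω => (x t ω, G.indicator (fun _ => (1 : ℝ)) ω)) (X t) μ)
    {n : ℕ} (hn : n ≠ 0) (t : ℕ) :
    ∫ ω in G, ‖x t ω‖ ^ (2 * n) ∂μ ≤
      ((1 + h) ^ (2 * n) * Real.exp (n * (h * b) ^ 2 + 2 * n ^ 2 * (h * b) ^ 2)) ^ t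
        * μ.real G := by
  set θ := (1 + h) ^ (2 * n) * Real.exp (n * (h * b) ^ 2 + 2 * n ^ 2 * (h * b) ^ 2) with hθ
  have hθ0 : 0 ≤ θ := by positivity
  induction t with
  | zero =>
    rw [setIntegral_congr_fun (g := fun _ => (1 : ℝ)) hGm fun ω hω => by simp [hG ω hω]]
    simp
  | succ t ih =>
    have := setIntegral_iterate_succ_le (f := fun y => ‖y‖ ^ (2 * n))
      (g := fun y => θ * ‖y‖ ^ (2 * n)) (C := 1) (C' := θ) (n := 2 * n) (n' := 2 * n)
      hXm hh hXb hxm hx hGm hG hind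
      (by fun_prop) (by fun_prop) (fun y => by simp)
      (fun y => by rw [abs_of_nonneg (by positivity)])
      fun y => integral_norm_pow_le hS1 (hXi t) (hXS t) hh (hXb t) hn y
    refine this.trans ?_
    rw [integral_const_mul, pow_succ', mul_assoc θ (θ ^ t)]
    exact mul_le_mul_of_nonneg_left ih hθ0

end SGD

/-- The eigenvalue one may be multiple: `v` lies in the span of those `u i` with `s i = 1`, and
Cauchy-Schwarz compares it with the projection onto that span. -/
lemma sq_inner_le_quadForm_one {S : Matrix (Fin d) (Fin d) ℝ} (hS : S.IsHermitian)
    {u : OrthonormalBasis (Fin d) ℝ (Vec d)} {s : Fin d → ℝ} (hu : ∀ i, app S (u i) = s i • u i)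
    {v : Vec d} (hv : ‖v‖ = 1) (hSv : app S v = v) (x : Vec d) :
    inner ℝ v x ^ 2 ≤ quadForm u (fun i => if s i = 1 then 1 else 0) x := by
  have h1 : ∀ i, s i ≠ 1 → inner ℝ (u i) v = 0 := fun i hi => by
    have := inner_eigenvector_app hS (hu i) v
    rw [hSv] at this
    have h : (s i - 1) * inner ℝ (u i) v = 0 := by linarith
    exact (mul_eq_zero.1 h).resolve_left (sub_ne_zero.2 hi)
  have h2 : inner ℝ v x = ∑ i, inner ℝ (u i) v * ((if s i = 1 then 1 else 0) * inner ℝ (u i) x) := by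
    rw [inner_eq_sum u]
    refine Finset.sum_congr rfl fun i _ => ?_
    by_cases hi : s i = 1
    · simp [hi]
    · simp [h1 i hi]
  have h3 : quadForm u (fun i => if s i = 1 then 1 else 0) x =
      ∑ i, ((if s i = 1 then 1 else 0) * inner ℝ (u i) x) ^ 2 := by
    refine Finset.sum_congr rfl fun i _ => ?_
    by_cases hi : s i = 1 <;> simp [hi]
  rw [h2, h3]
  refine (Finset.sum_mul_sq_le_sq_mul_sq _ _ _).trans ?_
  rw [← norm_sq_eq_sum u, hv]
  simp

/-- The parameters of the SGD theorem satisfy the scalar inequality that makes the expected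
potential negative. -/
lemma potCoeff_le {h b p ε : ℝ} {T : ℕ} (hb : 1 ≤ b) (hp : 8 ≤ p) (hT : 2 ≤ T)
    (hh : h = 1 / (b * √(p * T))) (hε : ε = 24 * (Real.log T * b * √p / √T)) (hε1 : ε < 1)
    {s : Fin d → ℝ} (hs0 : ∀ i, 0 ≤ s i) (i : Fin d) :
    potCoeff h b ε s T i ≤ (1 + h) ^ (2 * T) * (ε / (2 * p)) +
      -((1 + h) ^ (2 * T) * ε) * (if s i = 1 then 1 else 0) := by
  have hT' : (2 : ℝ) ≤ T := by exact_mod_cast hT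
  have hT0 : (0 : ℝ) < T := by linarith
  have hp0 : 0 < p := by linarith
  have hb0 : 0 < b := by linarith
  have hsp : 0 < √p := Real.sqrt_pos.2 hp0
  have hsT : 0 < √(T : ℝ) := Real.sqrt_pos.2 hT0
  have hspp : √p * √p = p := Real.mul_self_sqrt hp0.le
  have hsTT : √(T : ℝ) * √(T : ℝ) = T := Real.mul_self_sqrt hT0.le
  have hL : 0.69 ≤ Real.log T := by
    have := Real.log_le_log (by norm_num) hT'
    linarith [Real.log_two_gt_d9]
  have hL0 : 0 < Real.log T := by linarith
  have hsq : √(p * T) = √p * √(T : ℝ) := Real.sqrt_mul hp0.le _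
  rw [hsq] at hh
  have hh0 : 0 < h := by rw [hh]; positivity
  have hε0 : 0 < ε := by rw [hε]; positivity
  have hhb : h * b = 1 / (√p * √(T : ℝ)) := by rw [hh]; field_simp
  have hhbT : (h * b) ^ 2 * T = 1 / p := by
    rw [hhb, div_pow, mul_pow, sq, sq, sq, hspp, hsTT]; field_simp
  have hhε : h * ε * T = 24 * Real.log T := by
    rw [hh, hε]; field_simp; rw [sq, hsTT]
  have hεp : ε / p = 24 * (h * b ^ 2 * Real.log T) := by
    rw [hh, hε]; field_simp; rw [Real.sq_sqrt hp0.le]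
  -- `ε < 1` forces a long horizon, since `24 log T · b` exceeds 12.
  have hbT : 12 * √p ≤ √(T : ℝ) := by
    rw [hε, mul_div_assoc', div_lt_one hsT] at hε1
    have h1 : 0.69 * 1 ≤ Real.log T * b := mul_le_mul hL hb (by norm_num) hL0.le
    nlinarith
  have hh1 : h ≤ 1 := by
    rw [hh, div_le_one (by positivity)]
    have : 1 ≤ √p := by rw [Real.one_le_sqrt]; linarith
    have : 1 ≤ √p * √(T : ℝ) := by nlinarith
    nlinarith
  have hN : 0 < (1 + h) ^ (2 * T) := by positivity
  -- Half of the budget `ε / (2p)`: as `h ε T = 24 log T`, the exponential factor is at most `1 /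
  -- T`.
  have hgap : (1 + h * s i) ^ (2 * T) * (1 - ε - s i) ≤ (1 + h) ^ (2 * T) * (ε / (4 * p)) := by
    refine (pow_mul_gap_le_exp hh0 hh1 (hs0 i) hε0.le T).trans
      (mul_le_mul_of_nonneg_left ?_ hN.le)
    rw [hhε]
    calc Real.exp (-(24 * Real.log T)) ≤ Real.exp (-Real.log T) :=
          Real.exp_le_exp.2 (by linarith)
      _ = 1 / T := by rw [Real.exp_neg, Real.exp_log hT0, one_div]
      _ ≤ 6 * (h * b ^ 2 * Real.log T) := by
        have h1 : h * b ^ 2 = b / (√p * √(T : ℝ)) := by rw [hh]; field_simp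
        rw [h1, div_le_iff₀ hT0]
        have h2 : 6 * (b / (√p * √(T : ℝ)) * Real.log T) * T
            = 6 * b * Real.log T * (√(T : ℝ) / √p) := by
          field_simp; rw [Real.sq_sqrt hT0.le]
        rw [h2]
        have h3 : 12 ≤ √(T : ℝ) / √p := by rwa [le_div_iff₀ hsp]
        have h4 : 0.69 ≤ b * Real.log T := by nlinarith
        nlinarith
      _ = ε / (4 * p) := by
        rw [mul_comm 4 p, ← div_div, hεp]; ring
  -- The other half. The constants `2 · 2.5 · 1.2 = 6` account for the 24 in `ε`, because `ε / (4p)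
  -- = 6 h b² log T`.
  have hdrift : 2 * h * b ^ 2 * (∑ j ∈ Finset.range T, 1 / ((j : ℝ) + 1)) *
      ((1 + h) ^ 2 + h ^ 2 * b ^ 2) ^ T ≤ (1 + h) ^ (2 * T) * (ε / (4 * p)) := by
    have h1 : ∑ j ∈ Finset.range T, 1 / ((j : ℝ) + 1) ≤ 2.5 * Real.log T := by
      refine (sum_range_inv_le T).trans ?_
      linarith
    have h2 : ((1 + h) ^ 2 + h ^ 2 * b ^ 2) ^ T ≤ (1 + h) ^ (2 * T) * 1.2 := by
      calc ((1 + h) ^ 2 + h ^ 2 * b ^ 2) ^ T ≤ ((1 + h) ^ 2 * Real.exp ((h * b) ^ 2)) ^ T := by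
            refine pow_le_pow_left₀ (by positivity) ?_ T
            have h3 := Real.add_one_le_exp ((h * b) ^ 2)
            have h4 : 1 ≤ (1 + h) ^ 2 := one_le_pow₀ (by linarith)
            nlinarith [sq_nonneg (h * b)]
        _ = (1 + h) ^ (2 * T) * Real.exp (1 / p) := by
            rw [mul_pow, ← pow_mul, ← Real.exp_nat_mul, ← hhbT, mul_comm (T : ℝ)]
        _ ≤ _ := by
            refine mul_le_mul_of_nonneg_left ?_ hN.le
            have h5 : 1 / p ≤ 1 / 8 := one_div_le_one_div_of_le (by norm_num) hp
            have h6 : Real.exp (1 / p) ≤ 1 / (1 - 1 / p) := by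
              have h7 := Real.add_one_le_exp (-(1 / p))
              rw [Real.exp_neg] at h7
              rw [le_div_iff₀ (by linarith)]
              calc Real.exp (1 / p) * (1 - 1 / p)
                  ≤ Real.exp (1 / p) * (Real.exp (1 / p))⁻¹ := by
                    gcongr; linarith
                _ = 1 := mul_inv_cancel₀ (Real.exp_pos _).ne'
            refine h6.trans ?_
            rw [div_le_iff₀ (by linarith)]
            linarith
    calc _ ≤ 2 * h * b ^ 2 * (2.5 * Real.log T) * ((1 + h) ^ (2 * T) * 1.2) := by gcongr
      _ = (1 + h) ^ (2 * T) * (6 * (h * b ^ 2 * Real.log T)) := by ring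
      _ = _ := by rw [mul_comm 4 p, ← div_div, hεp]; ring
  have h24 : ε / (2 * p) = ε / (4 * p) + ε / (4 * p) := by field_simp; norm_num
  rw [potCoeff, h24]
  by_cases hi : s i = 1
  · have h1 : (1 + h * s i) ^ (2 * T) * (1 - ε - s i) = -((1 + h) ^ (2 * T) * ε) := by
      rw [hi]; ring
    have h2 : 0 ≤ (1 + h) ^ (2 * T) * (ε / (4 * p)) := by positivity
    rw [h1, if_pos hi]
    linarith
  · rw [if_neg hi]
    linarith

/-- Truncation at `K`: above the threshold, `Z / K ≤ (Z / K)^n`. -/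
lemma le_add_pow_div {Z K : ℝ} (hK : 0 < K) (hZ : 0 ≤ Z) {n : ℕ} (hn : n ≠ 0) :
    Z ≤ K + K * (Z ^ n / K ^ n) := by
  by_cases h : Z ≤ K
  · have : 0 ≤ K * (Z ^ n / K ^ n) := by positivity
    linarith
  · push Not at h
    have h1 : 1 ≤ Z / K := (one_le_div hK).2 h.le
    have h2 : Z / K ≤ (Z / K) ^ n := le_self_pow₀ h1 hn
    rw [div_pow] at h2
    have h3 : Z = K * (Z / K) := by field_simp
    have h4 := mul_le_mul_of_nonneg_left h2 hK.le
    linarith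

/-! ### From a negative mean to a lower bound on the probability -/

section SGD

variable {Ω : Type*} [MeasurableSpace Ω] {μ : Measure Ω} [IsProbabilityMeasure μ]
  {S : Matrix (Fin d) (Fin d) ℝ} {X : ℕ → Ω → Matrix (Fin d) (Fin d) ℝ} {b h : ℝ}
  {x : ℕ → Ω → Vec d} {G : Set Ω}

/-- The SGD theorem for a matrix of norm one, with the potential `quadForm u (1 - ε - s)`. -/
theorem measure_potential_neg_ge (hS : S.IsHermitian) (hS1 : ‖S‖ ≤ 1)
    {u : OrthonormalBasis (Fin d) ℝ (Vec d)}
    {s : Fin d → ℝ} (hu : ∀ i, app S (u i) = s i • u i) (hs0 : ∀ i, 0 ≤ s i) (hs1 : ∀ i, s i ≤ 1)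
    {v : Vec d} (hv : ‖v‖ = 1) (hSv : app S v = v)
    (hXm : ∀ t, Measurable (X t)) (hXi : ∀ t i j, Integrable (fun ω => X t ω i j) μ)
    (hXS : ∀ t i j, ∫ ω, X t ω i j ∂μ = S i j)
    (hXb : ∀ t, ∀ᵐ ω ∂μ, ‖X t ω‖ ≤ b ∧ ‖X t ω - S‖ ≤ b)
    (hxm : ∀ t, Measurable (x t))
    (hx : ∀ t ω, x (t + 1) ω = app (1 + h • X t ω) (x t ω)) (hGm : MeasurableSet G)
    {p : ℝ} (hG : ∀ ω ∈ G, ‖x 0 ω‖ = 1) (hGp : ∀ ω ∈ G, 1 / p ≤ inner ℝ v (x 0 ω) ^ 2)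
    (hind : ∀ t, IndepFun (fun ω => (x t ω, G.indicator (fun _ => (1 : ℝ)) ω)) (X t) μ)
    {T : ℕ} {ε : ℝ} (hb : 1 ≤ b) (hp : 8 ≤ p) (hT : 2 ≤ T)
    (hh : h = 1 / (b * √(p * T))) (hε : ε = 24 * (Real.log T * b * √p / √T)) (hε1 : ε < 1) :
    μ.real G * (1 / (4 * Real.exp 7 * p)) ≤
      μ.real (G ∩ {ω | quadForm u (fun i => 1 - ε - s i) (x T ω) < 0}) := by
  have hT' : (2 : ℝ) ≤ T := by exact_mod_cast hT
  have hT0 : (0 : ℝ) < T := by linarith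
  have hp0 : 0 < p := by linarith
  have hb0 : 0 < b := by linarith
  have hL0 : 0 < Real.log T := Real.log_pos (by linarith)
  have hh0 : 0 < h := by rw [hh]; positivity
  have hε0 : 0 < ε := by rw [hε]; positivity
  have hh1 : h ≤ 1 := by
    rw [hh, div_le_one (by positivity)]
    have : 1 ≤ √(p * T) := by rw [Real.one_le_sqrt]; nlinarith
    nlinarith
  set N : ℝ := (1 + h) ^ (2 * T) with hN
  have hN0 : 0 < N := by positivity
  set V : Ω → ℝ := fun ω => quadForm u (fun i => 1 - ε - s i) (x T ω) with hV
  have hVm : Measurable V := (measurable_quadForm _ _).comp (hxm T)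
  set F : Set Ω := {ω | V ω < 0} with hF
  have hFm : MeasurableSet F := measurableSet_lt hVm measurable_const
  have hVi : IntegrableOn V G μ :=
    integrableOn_iterate hh0.le hXb hxm hx hGm hG (measurable_quadForm _ _) (abs_quadForm_le _ _) T
  -- the expected potential is very negative
  have hneg : ∫ ω in G, V ω ∂μ ≤ -(N * (ε / (2 * p))) * μ.real G := by
    have h1 := setIntegral_quadForm_le hS hu hs0 hs1 hXm hXi hXS hh0 hh1 hXb hxm hx hGm hG hind
      hε0.le T 0
    rw [zero_add] at h1
    refine h1.trans ?_
    have h2 : ∀ ω ∈ G, quadForm u (potCoeff h b ε s T) (x 0 ω) ≤ -(N * (ε / (2 * p))) := by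
      intro ω hω
      refine (quadForm_mono u (potCoeff_le hb hp hT hh hε hε1 hs0) _).trans ?_
      have h3 : quadForm u (fun i => (1 + h) ^ (2 * T) * (ε / (2 * p)) +
          -((1 + h) ^ (2 * T) * ε) * (if s i = 1 then 1 else 0)) (x 0 ω) =
          N * (ε / (2 * p)) * ‖x 0 ω‖ ^ 2
            - N * ε * quadForm u (fun i => if s i = 1 then 1 else 0) (x 0 ω) := by
        rw [norm_sq_eq_sum u, quadForm, quadForm, Finset.mul_sum, Finset.mul_sum,
          ← Finset.sum_sub_distrib]
        exact Finset.sum_congr rfl fun i _ => by ring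
      have h4 := (hGp ω hω).trans (sq_inner_le_quadForm_one hS hu hv hSv (x 0 ω))
      have h5 := mul_le_mul_of_nonneg_left h4 (mul_pos hN0 hε0).le
      rw [h3, hG ω hω]
      have h6 : N * ε * (1 / p) = 2 * (N * (ε / (2 * p))) := by field_simp
      linarith
    have h7 := setIntegral_mono_on (integrableOn_iterate hh0.le hXb hxm hx hGm hG
      (measurable_quadForm u (potCoeff h b ε s T)) (abs_quadForm_le _ _) 0)
      (integrableOn_const (μ := μ) (s := G) (C := -(N * (ε / (2 * p)))) (measure_ne_top _ _)) hGm h2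
    rw [setIntegral_const, smul_eq_mul, mul_comm] at h7
    exact h7
  -- a moment of order about `p`
  obtain ⟨n, hn1, hn2⟩ : ∃ n : ℕ, p ≤ n ∧ (n : ℝ) ≤ p + 1 :=
    ⟨⌈p⌉₊, Nat.le_ceil p, (Nat.ceil_lt_add_one hp0.le).le⟩
  have hn8 : 8 ≤ n := by
    have : (8 : ℝ) ≤ n := hp.trans hn1
    exact_mod_cast this
  have hn0 : n ≠ 0 := by omega
  -- Over `T` steps the exponent is `(n + 2n²) / p`, at most `5n` because `n ≤ p + 1` and `p ≥ 8`.
  have hmom : ∫ ω in G, ‖x T ω‖ ^ (2 * n) ∂μ ≤ N ^ n * Real.exp (5 * n) * μ.real G := by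
    refine (setIntegral_norm_pow_le hS1 hXm hXi hXS hh0.le hXb hxm hx hGm hG hind hn0 T).trans ?_
    refine mul_le_mul_of_nonneg_right ?_ measureReal_nonneg
    rw [mul_pow, ← Real.exp_nat_mul, hN, ← pow_mul, ← pow_mul,
      show 2 * n * T = 2 * T * n by ring]
    refine mul_le_mul_of_nonneg_left (Real.exp_le_exp.2 ?_) (by positivity)
    have h1 : (h * b) ^ 2 * T = 1 / p := by
      have h0 : h * b = 1 / √(p * T) := by rw [hh]; field_simp
      rw [h0, div_pow, Real.sq_sqrt (by positivity)]
      field_simp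
    have h2 : (T : ℝ) * (n * (h * b) ^ 2 + 2 * n ^ 2 * (h * b) ^ 2) = (n + 2 * n ^ 2) * (1 / p) := by
      rw [← h1]; ring
    rw [h2, mul_one_div, div_le_iff₀ hp0]
    have hn' : (8 : ℝ) ≤ n := by exact_mod_cast hn8
    nlinarith
  -- `K^n` must beat the moment factor `e^(5n)`: what is left of the tail is `e^(7 - 2n)`, at most
  -- `1 / (4n)`.
  set K : ℝ := Real.exp 7 with hK
  have hK0 : 0 < K := Real.exp_pos 7
  have hZi : IntegrableOn (fun ω => ‖x T ω‖ ^ (2 * n)) G μ :=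
    integrableOn_iterate (f := fun y => ‖y‖ ^ (2 * n)) (C := 1) (n := 2 * n) hh0.le hXb hxm hx hGm
      hG (by fun_prop) (fun y => by simp) T
  have hpt : ∀ ω, -V ω ≤ ε * N * (K * F.indicator (fun _ => (1 : ℝ)) ω +
      K * (1 / (N ^ n * K ^ n)) * ‖x T ω‖ ^ (2 * n)) := by
    intro ω
    by_cases hω : ω ∈ F
    · have h1 : -V ω ≤ ε * ‖x T ω‖ ^ 2 := by
        have h2 := quadForm_mono u (c := fun _ => -ε) (c' := fun i => 1 - ε - s i)
          (fun i => by linarith [hs1 i]) (x T ω)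
        rw [quadForm_const] at h2
        simp only [hV]
        linarith
      have h3 := le_add_pow_div hK0 (Z := ‖x T ω‖ ^ 2 / N) (by positivity) hn0
      rw [div_pow, ← pow_mul, div_le_iff₀ hN0] at h3
      rw [Set.indicator_of_mem hω]
      refine h1.trans ((mul_le_mul_of_nonneg_left h3 hε0.le).trans (le_of_eq ?_))
      field_simp
    · have h1 : 0 ≤ V ω := not_lt.1 hω
      rw [Set.indicator_of_notMem hω]
      have : 0 ≤ ε * N * (K * 0 + K * (1 / (N ^ n * K ^ n)) * ‖x T ω‖ ^ (2 * n)) := by positivity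
      linarith
  have hind1 : IntegrableOn (F.indicator (fun _ => (1 : ℝ))) G μ :=
    (integrable_const (1 : ℝ)).indicator hFm
  have hint : ∫ ω in G, -V ω ∂μ ≤ ε * N * (K * μ.real (G ∩ F) +
      K * (1 / (N ^ n * K ^ n)) * ∫ ω in G, ‖x T ω‖ ^ (2 * n) ∂μ) := by
    refine (setIntegral_mono (g := fun ω => ε * N * (K * F.indicator (fun _ => (1 : ℝ)) ω +
      K * (1 / (N ^ n * K ^ n)) * ‖x T ω‖ ^ (2 * n))) hVi.neg (((hind1.const_mul K).add (hZi.const_mul _)).const_mul _)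
      hpt).trans (le_of_eq ?_)
    rw [integral_const_mul, integral_add (hind1.const_mul K) (hZi.const_mul _),
      integral_const_mul, integral_const_mul, integral_indicator hFm,
      Measure.restrict_restrict hFm, Set.inter_comm]
    simp
  rw [integral_neg] at hint
  have htail : K * (1 / (N ^ n * K ^ n)) * ∫ ω in G, ‖x T ω‖ ^ (2 * n) ∂μ ≤
      1 / (4 * p) * μ.real G := by
    calc _ ≤ K * (1 / (N ^ n * K ^ n)) * (N ^ n * Real.exp (5 * n) * μ.real G) := by gcongr
      _ = K * (Real.exp (5 * n) / K ^ n) * μ.real G := by field_simp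
      _ = Real.exp (7 - 2 * n) * μ.real G := by
        rw [hK, ← Real.exp_nat_mul, ← Real.exp_sub, ← Real.exp_add]
        congr 2
        ring
      _ ≤ 1 / (4 * n) * μ.real G := by
        gcongr
        exact exp_moment_le hn8
      _ ≤ _ := by gcongr
  have hfin : N * (ε / (2 * p)) * μ.real G ≤
      ε * N * (K * μ.real (G ∩ F) + 1 / (4 * p) * μ.real G) := by
    have := mul_le_mul_of_nonneg_left htail (mul_pos hε0 hN0).le
    linarith
  have hfin2 : 1 / (2 * p) * μ.real G ≤ K * μ.real (G ∩ F) + 1 / (4 * p) * μ.real G := by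
    refine le_of_mul_le_mul_left ?_ (mul_pos hε0 hN0)
    refine le_trans (le_of_eq ?_) hfin
    field_simp
  have h8 : 1 / (2 * p) = 1 / (4 * p) + 1 / (4 * p) := by field_simp; norm_num
  rw [h8] at hfin2
  have h9 : μ.real G * (1 / (4 * K * p)) = 1 / (4 * p) * μ.real G / K := by field_simp
  rw [h9, div_le_iff₀ hK0]
  linarith

end SGD

/-! ### The Frobenius norm -/

/-- The squared Frobenius norm. -/
def frobSq (M : Matrix (Fin d) (Fin d) ℝ) : ℝ := ∑ i, ∑ j, M i j ^ 2

lemma frobSq_nonneg (M : Matrix (Fin d) (Fin d) ℝ) : 0 ≤ frobSq M :=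
  Finset.sum_nonneg fun _ _ => Finset.sum_nonneg fun _ _ => sq_nonneg _

lemma sum_col_sq_le (M : Matrix (Fin d) (Fin d) ℝ) (j : Fin d) : ∑ i, M i j ^ 2 ≤ ‖M‖ ^ 2 := by
  have h := norm_app_le M (EuclideanSpace.single j (1 : ℝ))
  have h1 : ‖app M (EuclideanSpace.single j (1 : ℝ))‖ ^ 2 = ∑ i, M i j ^ 2 := by
    rw [EuclideanSpace.real_norm_sq_eq]
    simp [app_apply]
  rw [← h1]
  rw [EuclideanSpace.single, PiLp.norm_single, norm_one, mul_one] at h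
  exact pow_le_pow_left₀ (norm_nonneg _) h 2

lemma frobSq_le (M : Matrix (Fin d) (Fin d) ℝ) : frobSq M ≤ d * ‖M‖ ^ 2 := by
  rw [frobSq, Finset.sum_comm]
  refine (Finset.sum_le_card_nsmul _ _ _ fun j _ => sum_col_sq_le M j).trans (le_of_eq ?_)
  simp

lemma abs_entry_le_norm (M : Matrix (Fin d) (Fin d) ℝ) (i j : Fin d) : |M i j| ≤ ‖M‖ := by
  refine abs_le_of_sq_le_sq ((?_ : M i j ^ 2 ≤ _).trans (sum_col_sq_le M j)) (norm_nonneg _)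
  exact Finset.single_le_sum (f := fun i => M i j ^ 2) (fun i _ => sq_nonneg _) (Finset.mem_univ i)

lemma norm_app_sq_le_frobSq (M : Matrix (Fin d) (Fin d) ℝ) (x : Vec d) :
    ‖app M x‖ ^ 2 ≤ frobSq M * ‖x‖ ^ 2 := by
  rw [EuclideanSpace.real_norm_sq_eq, EuclideanSpace.real_norm_sq_eq, frobSq, Finset.sum_mul]
  refine Finset.sum_le_sum fun i _ => ?_
  rw [app_apply]
  exact Finset.sum_mul_sq_le_sq_mul_sq _ _ _

lemma norm_sq_le_frobSq (M : Matrix (Fin d) (Fin d) ℝ) : ‖M‖ ^ 2 ≤ frobSq M := by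
  have : ‖M‖ ≤ √(frobSq M) := by
    rw [Matrix.cstar_norm_def]
    refine ContinuousLinearMap.opNorm_le_bound _ (Real.sqrt_nonneg _) fun x => ?_
    refine le_of_sq_le_sq ?_ (by positivity)
    rw [mul_pow, Real.sq_sqrt (frobSq_nonneg M)]
    exact norm_app_sq_le_frobSq M x
  exact (Real.le_sqrt (norm_nonneg _) (frobSq_nonneg M)).1 this

lemma one_le_numRank {A : Matrix (Fin d) (Fin d) ℝ} (h0 : A ≠ 0) : 1 ≤ numRank A := by
  rw [numRank, one_le_div (by positivity)]
  exact norm_sq_le_frobSq A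

/-! ### Standard Gaussian vectors -/

section Gaussian

variable {Ω : Type*} [MeasurableSpace Ω] {μ : Measure Ω} {w : Ω → Vec d}

lemma hasLaw_inner_gaussian (hw : HasLaw w (stdGaussian (Vec d)) μ) (z : Vec d) :
    HasLaw (fun ω => inner ℝ z (w ω)) (gaussianReal 0 (‖z‖ ^ 2).toNNReal) μ := by
  have h : HasLaw (innerSL ℝ z) (gaussianReal 0 (‖z‖ ^ 2).toNNReal) (stdGaussian (Vec d)) :=
    ⟨(innerSL ℝ z).continuous.measurable.aemeasurable, by
      rw [IsGaussian.map_eq_gaussianReal, integral_strongDual_stdGaussian,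
        variance_dual_stdGaussian, innerSL_apply_norm]⟩
  exact h.comp hw

lemma integrable_inner_sq_gaussian (hw : HasLaw w (stdGaussian (Vec d)) μ) (z : Vec d) :
    Integrable (fun ω => inner ℝ z (w ω) ^ 2) μ := by
  have h := hasLaw_inner_gaussian hw z
  have h1 : MemLp (fun ω => inner ℝ z (w ω)) 2 μ := by
    have h2 : MemLp id 2 (μ.map fun ω => inner ℝ z (w ω)) := by
      rw [h.map_eq]; exact IsGaussian.memLp_two_id
    exact h2.comp_of_map h.aemeasurable
  exact h1.integrable_sq

lemma integral_inner_sq_gaussian (hw : HasLaw w (stdGaussian (Vec d)) μ) (z : Vec d) :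
    ∫ ω, inner ℝ z (w ω) ^ 2 ∂μ = ‖z‖ ^ 2 := by
  have h := hasLaw_inner_gaussian hw z
  rw [← variance_of_integral_eq_zero h.aemeasurable (by rw [h.integral_eq]; simp), h.variance_eq]
  simp

lemma norm_app_sq_eq (M : Matrix (Fin d) (Fin d) ℝ) (x : Vec d) :
    ‖app M x‖ ^ 2 = ∑ i, inner ℝ (WithLp.toLp 2 (M i) : Vec d) x ^ 2 := by
  rw [EuclideanSpace.real_norm_sq_eq]
  refine Finset.sum_congr rfl fun i _ => ?_
  rw [app_apply, PiLp.inner_apply]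
  congr 1
  exact Finset.sum_congr rfl fun j _ => by simp [mul_comm]

lemma integrable_norm_app_sq_gaussian (hw : HasLaw w (stdGaussian (Vec d)) μ)
    (M : Matrix (Fin d) (Fin d) ℝ) : Integrable (fun ω => ‖app M (w ω)‖ ^ 2) μ := by
  simp only [norm_app_sq_eq]
  exact integrable_finsetSum _ fun i _ => integrable_inner_sq_gaussian hw _

lemma integral_norm_app_sq_gaussian (hw : HasLaw w (stdGaussian (Vec d)) μ)
    (M : Matrix (Fin d) (Fin d) ℝ) : ∫ ω, ‖app M (w ω)‖ ^ 2 ∂μ = frobSq M := by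
  simp only [norm_app_sq_eq]
  rw [integral_finsetSum _ fun i _ => integrable_inner_sq_gaussian hw _, frobSq]
  refine Finset.sum_congr rfl fun i _ => ?_
  rw [integral_inner_sq_gaussian hw, EuclideanSpace.real_norm_sq_eq]

/-- The standard normal density is at most 0.4, and the interval has length one. -/
lemma measure_abs_inner_gaussian_lt (hw : HasLaw w (stdGaussian (Vec d)) μ) {v : Vec d}
    (hv : ‖v‖ = 1) : μ.real {ω | |inner ℝ v (w ω)| < 1 / 2} ≤ 0.4 := by
  have h := hasLaw_inner_gaussian hw v
  have hm : MeasurableSet {x : ℝ | |x| < 1 / 2} :=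
    measurableSet_lt (by fun_prop) measurable_const
  rw [h.measureReal_eq (p := fun x => |x| < 1 / 2) hm]
  have hvar : (‖v‖ ^ 2).toNNReal = 1 := by simp [hv]
  rw [hvar, Measure.real, gaussianReal_apply _ one_ne_zero]
  refine ENNReal.toReal_le_of_le_ofReal (by norm_num) ?_
  have hpdf : ∀ x, gaussianPDF 0 1 x ≤ ENNReal.ofReal 0.4 := fun x => by
    refine ENNReal.ofReal_le_ofReal ?_
    rw [gaussianPDFReal_def]
    have h1 : Real.exp (-(x - 0) ^ 2 / (2 * ((1 : NNReal) : ℝ))) ≤ 1 := by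
      rw [Real.exp_le_one_iff]
      simp only [NNReal.coe_one]
      have := sq_nonneg (x - 0)
      linarith
    have h2 : (√(2 * Real.pi * ((1 : NNReal) : ℝ)))⁻¹ ≤ 0.4 := by
      rw [inv_le_comm₀ (by simp [Real.pi_pos]) (by norm_num)]
      apply Real.le_sqrt_of_sq_le
      simp only [NNReal.coe_one]
      have := Real.pi_gt_d4
      norm_num
      linarith
    calc _ ≤ 0.4 * 1 := mul_le_mul h2 h1 (Real.exp_pos _).le (by norm_num)
      _ = 0.4 := by norm_num
  refine (lintegral_mono hpdf).trans ?_
  have hvol : volume {x : ℝ | |x| < 1 / 2} = 1 := by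
    have : {x : ℝ | |x| < 1 / 2} = Set.Ioo (-(1 / 2)) (1 / 2) := by
      ext x; simp [abs_lt]
    rw [this, Real.volume_Ioo]
    norm_num
  rw [lintegral_const, Measure.restrict_apply_univ, hvol, mul_one]

end Gaussian

/-! ### The empirical mean -/

section Init

variable {Ω : Type*} [MeasurableSpace Ω] {μ : Measure Ω} [IsProbabilityMeasure μ]
  {A : Matrix (Fin d) (Fin d) ℝ} {B : ℕ → Ω → Matrix (Fin d) (Fin d) ℝ} {R : ℝ}

/-- The mean of the first `n` matrices of a stream. -/
noncomputable def empMean (n : ℕ) (B : ℕ → Matrix (Fin d) (Fin d) ℝ) : Matrix (Fin d) (Fin d) ℝ :=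
  (1 / (n : ℝ)) • ∑ t ∈ Finset.range n, B t

lemma measurable_empMean (n : ℕ) :
    Measurable fun B : ℕ → Matrix (Fin d) (Fin d) ℝ => empMean n B :=
  Measurable.matrix_smul _ (Measurable.matrix_sum _ fun i => measurable_pi_apply i)

lemma norm_empMean_sub_le {n : ℕ} (hn : n ≠ 0) {B : ℕ → Matrix (Fin d) (Fin d) ℝ}
    (hB : ∀ t, ‖B t - A‖ ≤ R) : ‖empMean n B - A‖ ≤ R := by
  have hn' : (0 : ℝ) < n := by positivity
  have h : empMean n B - A = (1 / (n : ℝ)) • ∑ t ∈ Finset.range n, (B t - A) := by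
    rw [empMean, Finset.sum_sub_distrib, smul_sub, Finset.sum_const, Finset.card_range,
      ← Nat.cast_smul_eq_nsmul ℝ, smul_smul, one_div, inv_mul_cancel₀ hn'.ne', one_smul]
  rw [h, norm_smul, Real.norm_of_nonneg (by positivity), one_div, inv_mul_le_iff₀ hn']
  refine (norm_sum_le_of_le _ fun t _ => hB t).trans ?_
  simp

lemma integrable_frobSq_sub {M : Ω → Matrix (Fin d) (Fin d) ℝ} (hM : Measurable M)
    (hb : ∀ᵐ ω ∂μ, ‖M ω - A‖ ≤ R) : Integrable (fun ω => frobSq (M ω - A)) μ := by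
  refine Integrable.of_bound (C := d * R ^ 2) ?_ ?_
  · refine Measurable.aestronglyMeasurable ?_
    simp only [frobSq, Matrix.sub_apply]
    exact Finset.measurable_sum _ fun i _ => Finset.measurable_sum _ fun j _ =>
      (((measurable_matrix_entry i j).comp hM).sub_const _).pow_const 2
  · filter_upwards [hb] with ω hω
    rw [Real.norm_of_nonneg (frobSq_nonneg _)]
    refine (frobSq_le _).trans ?_
    gcongr

/-- Entrywise, the variance of a mean of `n` independent variables carries a factor `1 / n`; the `d`
comes from `frobSq ≤ d ‖·‖²`. -/
lemma integral_frobSq_empMean_sub_le (hBm : ∀ t, Measurable (B t)) (hB : iIndepFun B μ)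
    (hBi : ∀ t i j, Integrable (fun ω => B t ω i j) μ) (hBA : ∀ t i j, ∫ ω, B t ω i j ∂μ = A i j)
    (hBb : ∀ t, ∀ᵐ ω ∂μ, ‖B t ω - A‖ ≤ R) {n : ℕ} (hn : n ≠ 0) :
    ∫ ω, frobSq (empMean n (fun t => B t ω) - A) ∂μ ≤ d * R ^ 2 / n := by
  have hn' : (n : ℝ) ≠ 0 := by positivity
  have hmeas : ∀ t i j, Measurable fun ω => B t ω i j := fun t i j =>
    (measurable_matrix_entry i j).comp (hBm t)
  have hLp : ∀ t i j, MemLp (fun ω => B t ω i j) 2 μ := fun t i j => by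
    refine MemLp.of_bound (hmeas t i j).aestronglyMeasurable (R + |A i j|) ?_
    filter_upwards [hBb t] with ω hω
    have h1 := (abs_entry_le_norm (B t ω - A) i j).trans hω
    have h2 := abs_add_le (B t ω i j - A i j) (A i j)
    rw [sub_add_cancel] at h2
    rw [Matrix.sub_apply] at h1
    exact h2.trans (by linarith)
  have hLps : ∀ i j, MemLp (fun ω => empMean n (fun t => B t ω) i j) 2 μ := fun i j => by
    have := (memLp_finsetSum (Finset.range n) fun t _ => hLp t i j).const_mul (1 / (n : ℝ))
    simpa [empMean, Matrix.sum_apply] using this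
  have hsq : ∀ i j, Integrable (fun ω => (empMean n (fun t => B t ω) - A) i j ^ 2) μ :=
    fun i j => ((hLps i j).sub (memLp_const (A i j))).integrable_sq
  have hsqB : ∀ t i j, Integrable (fun ω => (B t ω - A) i j ^ 2) μ :=
    fun t i j => ((hLp t i j).sub (memLp_const (A i j))).integrable_sq
  have hmean : ∀ i j, ∫ ω, empMean n (fun t => B t ω) i j ∂μ = A i j := fun i j => by
    simp only [empMean, Matrix.smul_apply, Matrix.sum_apply, smul_eq_mul]
    rw [integral_const_mul, integral_finsetSum _ fun t _ => hBi t i j]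
    simp only [hBA, Finset.sum_const, Finset.card_range, nsmul_eq_mul]
    field_simp
  have hentry : ∀ i j, ∫ ω, (empMean n (fun t => B t ω) - A) i j ^ 2 ∂μ =
      (1 / (n : ℝ)) ^ 2 * ∑ t ∈ Finset.range n, ∫ ω, (B t ω - A) i j ^ 2 ∂μ := fun i j => by
    have h1 : ∫ ω, (empMean n (fun t => B t ω) - A) i j ^ 2 ∂μ =
        variance (fun ω => empMean n (fun t => B t ω) i j) μ := by
      rw [variance_eq_integral (hLps i j).aestronglyMeasurable.aemeasurable, hmean]
      rfl
    have h2 : ∀ t, ∫ ω, (B t ω - A) i j ^ 2 ∂μ = variance (fun ω => B t ω i j) μ := fun t => by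
      rw [variance_eq_integral (hmeas t i j).aemeasurable, hBA]
      rfl
    have h3 : (fun ω => empMean n (fun t => B t ω) i j) =
        fun ω => 1 / (n : ℝ) * (∑ t ∈ Finset.range n, fun ω => B t ω i j) ω := by
      ext ω
      simp [empMean, Matrix.sum_apply]
    rw [h1, h3, variance_const_mul, IndepFun.variance_sum (fun t _ => hLp t i j)]
    · simp only [h2]
    · intro t _ t' _ htt
      exact (hB.indepFun htt).comp (measurable_matrix_entry i j) (measurable_matrix_entry i j)
  have hBF : ∀ t, ∑ i, ∑ j, ∫ ω, (B t ω - A) i j ^ 2 ∂μ ≤ d * R ^ 2 := fun t => by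
    have h1 : ∑ i, ∑ j, ∫ ω, (B t ω - A) i j ^ 2 ∂μ = ∫ ω, frobSq (B t ω - A) ∂μ := by
      simp only [frobSq]
      rw [integral_finsetSum _ fun i _ => integrable_finsetSum _ fun j _ => hsqB t i j]
      exact Finset.sum_congr rfl fun i _ => (integral_finsetSum _ fun j _ => hsqB t i j).symm
    have h2 : ∫ ω, frobSq (B t ω - A) ∂μ ≤ ∫ _, d * R ^ 2 ∂μ := by
      refine integral_mono_ae (integrable_frobSq_sub (hBm t) (hBb t)) (integrable_const _) ?_
      filter_upwards [hBb t] with ω hω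
      refine (frobSq_le _).trans ?_
      gcongr
    rw [h1]
    simpa using h2
  calc ∫ ω, frobSq (empMean n (fun t => B t ω) - A) ∂μ
      = ∑ i, ∑ j, ∫ ω, (empMean n (fun t => B t ω) - A) i j ^ 2 ∂μ := by
        simp only [frobSq]
        rw [integral_finsetSum _ fun i _ => integrable_finsetSum _ fun j _ => hsq i j]
        exact Finset.sum_congr rfl fun i _ => integral_finsetSum _ fun j _ => hsq i j
    _ = (1 / (n : ℝ)) ^ 2 * ∑ t ∈ Finset.range n, ∑ i, ∑ j, ∫ ω, (B t ω - A) i j ^ 2 ∂μ := by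
        simp only [hentry]
        rw [Finset.sum_comm' (t' := Finset.univ) (s' := fun _ => Finset.range n) (by simp),
          Finset.mul_sum]
        refine Finset.sum_congr rfl fun i _ => ?_
        rw [Finset.sum_comm, Finset.mul_sum]
    _ ≤ (1 / (n : ℝ)) ^ 2 * (n * (d * R ^ 2)) := by
        refine mul_le_mul_of_nonneg_left ?_ (by positivity)
        refine (Finset.sum_le_card_nsmul _ _ _ fun t _ => hBF t).trans (le_of_eq ?_)
        simp
    _ = _ := by field_simp

variable {w : Ω → Vec d}

/-- For a fixed matrix the Gaussian mean of `‖M w‖²` is the squared Frobenius norm, and `w` is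
independent of the empirical mean. -/
lemma integral_norm_app_empMean_sub_sq_le (hBm : ∀ t, Measurable (B t)) (hB : iIndepFun B μ)
    (hBi : ∀ t i j, Integrable (fun ω => B t ω i j) μ) (hBA : ∀ t i j, ∫ ω, B t ω i j ∂μ = A i j)
    (hBb : ∀ t, ∀ᵐ ω ∂μ, ‖B t ω - A‖ ≤ R) (hwm : Measurable w)
    (hw : HasLaw w (stdGaussian (Vec d)) μ) (hwB : IndepFun w (fun ω t => B t ω) μ)
    {n : ℕ} (hn : n ≠ 0) :
    Integrable (fun ω => ‖app (empMean n (fun t => B t ω) - A) (w ω)‖ ^ 2) μ ∧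
    ∫ ω, ‖app (empMean n (fun t => B t ω) - A) (w ω)‖ ^ 2 ∂μ ≤ d * R ^ 2 / n := by
  have hMm : Measurable fun ω => empMean n (fun t => B t ω) :=
    (measurable_empMean n).comp (measurable_pi_lambda _ hBm)
  have hMb : ∀ᵐ ω ∂μ, ‖empMean n (fun t => B t ω) - A‖ ≤ R := by
    filter_upwards [ae_all_iff.2 hBb] with ω hω using norm_empMean_sub_le hn hω
  have hsub : Measurable fun M : Matrix (Fin d) (Fin d) ℝ => M - A := by
    refine measurable_matrix_of_entry fun i j => ?_
    exact (measurable_matrix_entry i j).sub_const (A i j)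
  have hint : Integrable (fun ω => ‖app (empMean n (fun t => B t ω) - A) (w ω)‖ ^ 2) μ := by
    have hw2 : Integrable (fun ω => ‖w ω‖ ^ 2) μ := by
      simpa [app_one] using integrable_norm_app_sq_gaussian hw 1
    refine (hw2.const_mul (R ^ 2)).mono' ?_ ?_
    · exact ((Measurable.app (hsub.comp hMm) hwm).norm.pow_const 2).aestronglyMeasurable
    · filter_upwards [hMb] with ω hω
      rw [Real.norm_of_nonneg (by positivity), ← mul_pow]
      exact pow_le_pow_left₀ (norm_nonneg _) ((norm_app_le _ _).trans
        (mul_le_mul_of_nonneg_right hω (norm_nonneg _))) 2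
  refine ⟨hint, ?_⟩
  refine le_trans ?_ (integral_frobSq_empMean_sub_le hBm hB hBi hBA hBb hn)
  have hindep : IndepFun (fun ω => empMean n (fun t => B t ω)) w μ :=
    hwB.symm.comp (measurable_empMean n) measurable_id
  refine hindep.integral_le_integral (φ := fun M y => ‖app (M - A) y‖ ^ 2)
    (ψ := fun M => frobSq (M - A)) hMm hwm ?_ ?_ hint (integrable_frobSq_sub hMm hMb)
    fun M => (integral_norm_app_sq_gaussian hw (M - A)).le
  · exact (Measurable.app (hsub.comp measurable_fst) measurable_snd).norm.pow_const 2
  · simp only [frobSq, Matrix.sub_apply]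
    exact Finset.measurable_sum _ fun i _ => Finset.measurable_sum _ fun j _ =>
      ((measurable_matrix_entry i j).sub_const _).pow_const 2

/-- One approximate power iteration is well correlated with a leading eigenvector if the
perturbation is small and the Gaussian vector is typical. -/
lemma one_div_inner_unitize_sq_le {M : Matrix (Fin d) (Fin d) ℝ} (hA : A.IsHermitian)
    (h0 : A ≠ 0) {v x : Vec d} (hv : ‖v‖ = 1) (hAv : app A v = ‖A‖ • v)
    (h1 : 1 / 2 ≤ |inner ℝ v x|) (h2 : ‖app A x‖ ^ 2 ≤ 10 * frobSq A)
    (h3 : ‖app (M - A) x‖ ^ 2 ≤ ‖A‖ ^ 2 / 16) :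
    inner ℝ v (unitize (app M x)) ≠ 0 ∧
      1 / inner ℝ v (unitize (app M x)) ^ 2 ≤ 336 * numRank A := by
  have ha : 0 < ‖A‖ := norm_pos_iff.2 h0
  have h4 : ‖app (M - A) x‖ ≤ ‖A‖ / 4 := by
    refine le_of_sq_le_sq (h3.trans (le_of_eq (by ring))) (by positivity)
  have hM : app M x = app A x + app (M - A) x := by rw [app_sub_left]; abel
  have h5 : inner ℝ v (app M x) = ‖A‖ * inner ℝ v x + inner ℝ v (app (M - A) x) := by
    rw [hM, inner_add_right, inner_eigenvector_app hA hAv]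
  have h6 : |inner ℝ v (app (M - A) x)| ≤ ‖A‖ / 4 := by
    refine (abs_real_inner_le_norm _ _).trans ?_
    rwa [hv, one_mul]
  have h7 : ‖A‖ / 4 ≤ |inner ℝ v (app M x)| := by
    have h8 : ‖A‖ * (1 / 2) ≤ |‖A‖ * inner ℝ v x| := by
      rw [abs_mul, abs_of_pos ha]
      exact mul_le_mul_of_nonneg_left h1 ha.le
    have h9 := abs_sub_abs_le_abs_sub (‖A‖ * inner ℝ v x) (-inner ℝ v (app (M - A) x))
    rw [abs_neg, sub_neg_eq_add, ← h5] at h9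
    linarith
  have h8 : inner ℝ v (app M x) ≠ 0 := fun h => by
    rw [h, abs_zero] at h7; linarith
  have h9 : app M x ≠ 0 := fun h => h8 (by rw [h, inner_zero_right])
  have hn : 0 < ‖app M x‖ := norm_pos_iff.2 h9
  have h10 : inner ℝ v (unitize (app M x)) = ‖app M x‖⁻¹ * inner ℝ v (app M x) := by
    rw [unitize, real_inner_smul_right]
  have hF : ‖A‖ ^ 2 ≤ frobSq A := norm_sq_le_frobSq A
  -- Doubling the squares gives `20 + 1/8`; together with `|⟨v, M x⟩| ≥ ‖A‖ / 4` this makes `336 =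
  -- 21 · 16`.
  have h11 : ‖app M x‖ ^ 2 ≤ 21 * frobSq A := by
    have h12 : ‖app M x‖ ≤ ‖app A x‖ + ‖app (M - A) x‖ := by rw [hM]; exact norm_add_le _ _
    have h13 := pow_le_pow_left₀ hn.le h12 2
    nlinarith [sq_nonneg (‖app A x‖ - ‖app (M - A) x‖)]
  have h14 : ‖A‖ ^ 2 / 16 ≤ inner ℝ v (app M x) ^ 2 := by
    have := pow_le_pow_left₀ (by positivity) h7 2
    rw [sq_abs] at this
    linarith
  rw [h10]
  refine ⟨mul_ne_zero (inv_ne_zero hn.ne') h8, ?_⟩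
  rw [mul_pow, inv_pow, one_div, mul_inv, inv_inv]
  change _ ≤ 336 * (frobSq A / ‖A‖ ^ 2)
  rw [← div_eq_mul_inv, div_le_iff₀ (by positivity)]
  calc ‖app M x‖ ^ 2 ≤ 21 * frobSq A := h11
    _ = 336 * (frobSq A / ‖A‖ ^ 2) * (‖A‖ ^ 2 / 16) := by field_simp; ring
    _ ≤ _ := mul_le_mul_of_nonneg_left h14 (by have := frobSq_nonneg A; positivity)

theorem goodInit_prob_ge (hd : 2 ≤ d) (hA : A.IsHermitian) (h0 : A ≠ 0)
    (hBm : ∀ t, Measurable (B t)) (hB : iIndepFun B μ)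
    (hBi : ∀ t i j, Integrable (fun ω => B t ω i j) μ) (hBA : ∀ t i j, ∫ ω, B t ω i j ∂μ = A i j)
    {b : ℝ} (hb : 1 ≤ b) (hBb : ∀ t, ∀ᵐ ω ∂μ, ‖B t ω - A‖ ≤ b * ‖A‖) (hwm : Measurable w)
    (hw : HasLaw w (stdGaussian (Vec d)) μ) (hwB : IndepFun w (fun ω t => B t ω) μ)
    {n : ℕ} (hn : 300 * d * b ^ 2 * Real.log d ≤ n) {v : Vec d} (hv : ‖v‖ = 1)
    (hAv : app A v = ‖A‖ • v) {p : ℝ} (hp : p = 500 * (Real.log d * numRank A)) :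
    0.4 ≤ μ.real (goodInit n B w v p) := by
  have hd' : (2 : ℝ) ≤ d := by exact_mod_cast hd
  have hL : 0.69 ≤ Real.log d := by
    have := Real.log_le_log (by norm_num) hd'
    linarith [Real.log_two_gt_d9]
  have ha : 0 < ‖A‖ := norm_pos_iff.2 h0
  have hF : 0 < frobSq A := lt_of_lt_of_le (by positivity) (norm_sq_le_frobSq A)
  have hnpos : (0 : ℝ) < n := lt_of_lt_of_le (by positivity) hn
  have hn0 : n ≠ 0 := by rintro rfl; simp at hnpos
  set D : Ω → ℝ := fun ω => ‖app (empMean n (fun t => B t ω) - A) (w ω)‖ ^ 2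
  obtain ⟨hDi, hDle⟩ := integral_norm_app_empMean_sub_sq_le hBm hB hBi hBA hBb hwm hw hwB hn0
  have hD : μ.real {ω | ‖A‖ ^ 2 / 16 ≤ D ω} ≤ 0.1 := by
    have h1 := mul_meas_ge_le_integral_of_nonneg (.of_forall fun ω => by positivity) hDi
      (‖A‖ ^ 2 / 16)
    have h2 : d * (b * ‖A‖) ^ 2 / n ≤ ‖A‖ ^ 2 / 16 * 0.1 := by
      rw [div_le_iff₀ hnpos]
      -- `300 · 0.69 = 207`, and 160 suffices for Markov. The logarithm enters only through `log d ≥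
      -- 0.69`.
      have h3 : 207 * (d * b ^ 2) ≤ n := by
        refine le_trans ?_ hn
        have : 0 ≤ (d : ℝ) * b ^ 2 := by positivity
        nlinarith
      have h4 := mul_le_mul_of_nonneg_left h3 (sq_nonneg ‖A‖)
      have : 0 ≤ ‖A‖ ^ 2 * (d * b ^ 2) := by positivity
      nlinarith
    exact le_of_mul_le_mul_left ((h1.trans hDle).trans h2) (by positivity)
  have hAw : μ.real {ω | 10 * frobSq A ≤ ‖app A (w ω)‖ ^ 2} ≤ 0.1 := by
    have h1 := mul_meas_ge_le_integral_of_nonneg (.of_forall fun ω => by positivity)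
      (integrable_norm_app_sq_gaussian hw A) (10 * frobSq A)
    rw [integral_norm_app_sq_gaussian hw] at h1
    refine le_of_mul_le_mul_left (h1.trans ?_) (by positivity : 0 < 10 * frobSq A)
    linarith
  have hv' := measure_abs_inner_gaussian_lt hw hv
  -- The three bad events have probabilities at most 0.4, 0.1 and 0.1, which leaves 0.4.
  have hcover : (Set.univ : Set Ω) ⊆ goodInit n B w v p ∪ ({ω | |inner ℝ v (w ω)| < 1 / 2} ∪
      ({ω | 10 * frobSq A ≤ ‖app A (w ω)‖ ^ 2} ∪ {ω | ‖A‖ ^ 2 / 16 ≤ D ω})) := by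
    intro ω _
    by_contra hω
    simp only [Set.mem_union, Set.mem_ofPred_eq, not_or, not_lt, not_le] at hω
    obtain ⟨hg, h1, h2, h3⟩ := hω
    obtain ⟨h4, h5⟩ := one_div_inner_unitize_sq_le hA h0 hv hAv h1 h2.le h3.le
    refine hg ⟨h4, h5.trans ?_⟩
    rw [hp]
    nlinarith [one_le_numRank h0]
  have h := measureReal_mono (μ := μ) hcover
  rw [probReal_univ] at h
  have e1 := measureReal_union_le (μ := μ) (goodInit n B w v p)
    ({ω | |inner ℝ v (w ω)| < 1 / 2} ∪
      ({ω | 10 * frobSq A ≤ ‖app A (w ω)‖ ^ 2} ∪ {ω | ‖A‖ ^ 2 / 16 ≤ D ω}))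
  have e2 := measureReal_union_le (μ := μ) {ω | |inner ℝ v (w ω)| < 1 / 2}
      ({ω | 10 * frobSq A ≤ ‖app A (w ω)‖ ^ 2} ∪ {ω | ‖A‖ ^ 2 / 16 ≤ D ω})
  have e3 := measureReal_union_le (μ := μ)
      {ω | 10 * frobSq A ≤ ‖app A (w ω)‖ ^ 2} {ω | ‖A‖ ^ 2 / 16 ≤ D ω}
  linarith

end Init

/-! ### Suboptimality through the potential, nonvanishing iterates -/

lemma inner_app_eq_quadForm {A : Matrix (Fin d) (Fin d) ℝ} (hA : A.IsHermitian)
    {u : OrthonormalBasis (Fin d) ℝ (Vec d)} {s : Fin d → ℝ} (hu : ∀ i, app A (u i) = s i • u i)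
    (x : Vec d) : inner ℝ x (app A x) = quadForm u s x := by
  rw [inner_eq_sum u, quadForm]
  refine Finset.sum_congr rfl fun i _ => ?_
  rw [inner_eigenvector_app hA (hu i)]
  ring

lemma inner_app_nonneg {A : Matrix (Fin d) (Fin d) ℝ} (hA : A.PosSemidef) (x : Vec d) :
    0 ≤ inner ℝ x (app A x) := by
  obtain ⟨u, s, hu, hs0, -⟩ := exists_eigenbasis hA
  rw [inner_app_eq_quadForm hA.1 hu]
  exact Finset.sum_nonneg fun i _ => mul_nonneg (hs0 i) (sq_nonneg _)

/-- The inner product of `x` with its image is at least `‖x‖²`. It keeps the output a unit vector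
when the accuracy bound is trivial. -/
lemma app_one_add_smul_ne_zero {M : Matrix (Fin d) (Fin d) ℝ} (hM : M.PosSemidef) {h : ℝ}
    (hh : 0 ≤ h) {x : Vec d} (hx : x ≠ 0) : app (1 + h • M) x ≠ 0 := by
  intro h0
  have h1 : inner ℝ x (app (1 + h • M) x) = ‖x‖ ^ 2 + h * inner ℝ x (app M x) := by
    rw [app_one_add_smul, inner_add_right, real_inner_smul_right, real_inner_self_eq_norm_sq]
  rw [h0, inner_zero_right] at h1
  have h2 : 0 < ‖x‖ := norm_pos_iff.2 hx
  have h3 := mul_nonneg hh (inner_app_nonneg hM x)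
  have h4 : 0 < ‖x‖ ^ 2 := by positivity
  linarith

lemma sgdIter_ne_zero {η : ℝ} (hη : 0 ≤ η) {B : ℕ → Matrix (Fin d) (Fin d) ℝ}
    (hB : ∀ t, (B t).PosSemidef) {x : Vec d} (hx : x ≠ 0) (t : ℕ) : sgdIter η B x t ≠ 0 := by
  induction t with
  | zero => exact hx
  | succ t ih => exact app_one_add_smul_ne_zero (hB t) hη ih

lemma subopt_le_one {A : Matrix (Fin d) (Fin d) ℝ} (hA : A.PosSemidef) (x : Vec d) :
    subopt A x ≤ 1 := by
  have : 0 ≤ inner ℝ x (app A x) / ‖A‖ := div_nonneg (inner_app_nonneg hA x) (norm_nonneg _)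
  rw [subopt]
  linarith

lemma subopt_unitize_le {A : Matrix (Fin d) (Fin d) ℝ} (hA : A.IsHermitian)
    {u : OrthonormalBasis (Fin d) ℝ (Vec d)} {s : Fin d → ℝ} (hu : ∀ i, app A (u i) = s i • u i)
    {ε : ℝ} {x : Vec d} (h : quadForm u (fun i => 1 - ε - s i / ‖A‖) x < 0) :
    ‖unitize x‖ = 1 ∧ subopt A (unitize x) ≤ ε := by
  have hx : x ≠ 0 := by
    rintro rfl
    simp [quadForm] at h
  refine ⟨norm_unitize hx, ?_⟩
  have hn : 0 < ‖x‖ := norm_pos_iff.2 hx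
  have h1 : quadForm u (fun i => 1 - ε - s i / ‖A‖) x =
      (1 - ε) * ‖x‖ ^ 2 - inner ℝ x (app A x) / ‖A‖ := by
    rw [inner_app_eq_quadForm hA hu, norm_sq_eq_sum u, quadForm, quadForm, Finset.mul_sum,
      Finset.sum_div, ← Finset.sum_sub_distrib]
    exact Finset.sum_congr rfl fun i _ => by ring
  have h2 : inner ℝ (unitize x) (app A (unitize x)) / ‖A‖ =
      (inner ℝ x (app A x) / ‖A‖) / ‖x‖ ^ 2 := by
    have : app A (unitize x) = ‖x‖⁻¹ • app A x := by simp [app, unitize]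
    rw [this, unitize, real_inner_smul_left, real_inner_smul_right]
    field_simp
  have h3 : 1 - ε ≤ (inner ℝ x (app A x) / ‖A‖) / ‖x‖ ^ 2 := by
    rw [le_div_iff₀ (by positivity)]
    linarith
  rw [subopt, h2]
  linarith

lemma powerInit_truncate {n T₀ : ℕ} (h : T₀ ≤ n) (B : ℕ → Matrix (Fin d) (Fin d) ℝ) (x : Vec d) :
    powerInit T₀ (truncate n B) x = powerInit T₀ B x := by
  rw [powerInit, powerInit, Finset.sum_congr rfl fun t ht =>
    truncate_of_lt B ((Finset.mem_range.1 ht).trans_le h)]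

lemma sgdIter_congr {η : ℝ} {B B' : ℕ → Matrix (Fin d) (Fin d) ℝ} (x : Vec d) (t : ℕ)
    (h : ∀ i < t, B i = B' i) : sgdIter η B x t = sgdIter η B' x t := by
  induction t with
  | zero => rfl
  | succ t ih => rw [sgdIter, sgdIter, ih fun i hi => h i (by omega), h t (by omega)]

/-! ### The algorithm on the stream, reduced to norm one -/

section Algorithm

variable {Ω : Type*} [MeasurableSpace Ω] {μ : Measure Ω} [IsProbabilityMeasure μ]
  {A : Matrix (Fin d) (Fin d) ℝ} {B : ℕ → Ω → Matrix (Fin d) (Fin d) ℝ} {w : Ω → Vec d}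

/-- The state of the algorithm after `t` steps, together with the event of a good start, is
independent of the next sample. -/
lemma indepFun_sgdIter (hBm : ∀ t, Measurable (B t)) (hB : iIndepFun B μ) (hwm : Measurable w)
    (hwB : IndepFun w (fun ω t => B t ω) μ) (T₀ : ℕ) (η p : ℝ) (v : Vec d) (t : ℕ) :
    IndepFun (fun ω => (sgdIter η (fun t => B (T₀ + t) ω)
        (powerInit T₀ (fun t => B t ω) (w ω)) t,
      (goodInit T₀ B w v p).indicator (fun _ => (1 : ℝ)) ω)) (B (T₀ + t)) μ := by
  have hB' : ∀ i, Measurable fun y : Vec d × (ℕ → Matrix (Fin d) (Fin d) ℝ) => y.2 i := fun i =>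
    (measurable_pi_apply i).comp measurable_snd
  have hinit : Measurable fun y : Vec d × (ℕ → Matrix (Fin d) (Fin d) ℝ) => powerInit T₀ y.2 y.1 :=
    Measurable.powerInit T₀ hB' measurable_fst
  have hsgd : Measurable fun y : Vec d × (ℕ → Matrix (Fin d) (Fin d) ℝ) =>
      sgdIter η (fun t => y.2 (T₀ + t)) (powerInit T₀ y.2 y.1) t :=
    Measurable.sgdIter η (fun i => hB' (T₀ + i)) hinit t
  have hset : MeasurableSet (goodInit T₀
      (fun t (y : Vec d × (ℕ → Matrix (Fin d) (Fin d) ℝ)) => y.2 t) (fun y => y.1) v p) := by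
    have h1 : Measurable fun y : Vec d × (ℕ → Matrix (Fin d) (Fin d) ℝ) => inner ℝ v (powerInit T₀ y.2 y.1) := by fun_prop
    exact (measurableSet_eq_fun h1 measurable_const).compl.inter
      (measurableSet_le ((h1.pow_const 2).const_div 1) measurable_const)
  have hone : Measurable fun _ : Vec d × (ℕ → Matrix (Fin d) (Fin d) ℝ) => (1 : ℝ) :=
    measurable_const
  have h := (indepFun_truncate hBm hB hwm hwB (T₀ + t)).comp
    (hsgd.prodMk (hone.indicator hset)) measurable_id
  convert h using 1
  swap
  · rfl
  ext1 ω
  refine Prod.ext ?_ ?_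
  · simp only [Function.comp_apply]
    rw [powerInit_truncate (by omega)]
    exact sgdIter_congr _ _ fun i hi => (truncate_of_lt (fun t => B t ω) (by omega)).symm
  · simp only [Function.comp_apply]
    have : ω ∈ goodInit T₀ B w v p ↔ (w ω, truncate (T₀ + t) fun t => B t ω) ∈
        goodInit T₀ (fun t (y : Vec d × (ℕ → Matrix (Fin d) (Fin d) ℝ)) => y.2 t)
          (fun y => y.1) v p := by
      change _ ∧ _ ↔ inner ℝ v (powerInit T₀ (truncate (T₀ + t) fun t => B t ω) (w ω)) ≠ 0 ∧
        1 / inner ℝ v (powerInit T₀ (truncate (T₀ + t) fun t => B t ω) (w ω)) ^ 2 ≤ p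
      rw [powerInit_truncate (by omega)]
    by_cases hω : ω ∈ goodInit T₀ B w v p
    · rw [Set.indicator_of_mem hω, Set.indicator_of_mem (this.1 hω)]
    · rw [Set.indicator_of_notMem hω, Set.indicator_of_notMem fun h => hω (this.2 h)]

lemma measurableSet_goodInit (hBm : ∀ t, Measurable (B t)) (hwm : Measurable w) (T₀ : ℕ) (p : ℝ)
    (v : Vec d) : MeasurableSet (goodInit T₀ B w v p) := by
  have h1 : Measurable fun ω => inner ℝ v (powerInit T₀ (fun t => B t ω) (w ω)) := by
    have := Measurable.powerInit T₀ hBm hwm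
    fun_prop
  exact (measurableSet_eq_fun h1 measurable_const).compl.inter
    (measurableSet_le ((h1.pow_const 2).const_div 1) measurable_const)

lemma norm_powerInit_of_mem_goodInit {Ω : Type*} {B : ℕ → Ω → Matrix (Fin d) (Fin d) ℝ}
    {w : Ω → Vec d} {T₀ : ℕ} {p : ℝ} {v : Vec d} {ω : Ω}
    (hω : ω ∈ goodInit T₀ B w v p) : ‖powerInit T₀ (fun t => B t ω) (w ω)‖ = 1 := by
  refine norm_unitize fun h => hω.1 ?_
  rw [powerInit, h, unitize, smul_zero, inner_zero_right]

theorem measure_goodInit_inter_success_ge (hA : A.PosSemidef) (h0 : A ≠ 0)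
    (hBm : ∀ t, Measurable (B t)) (hB : iIndepFun B μ)
    (hBpos : ∀ t, ∀ᵐ ω ∂μ, (B t ω).PosSemidef)
    (hBi : ∀ t i j, Integrable (fun ω => B t ω i j) μ) (hBA : ∀ t i j, ∫ ω, B t ω i j ∂μ = A i j)
    {b : ℝ} (hb : 1 ≤ b) (hBb : ∀ t, ∀ᵐ ω ∂μ, ‖B t ω‖ / ‖A‖ ≤ b ∧ ‖B t ω - A‖ / ‖A‖ ≤ b)
    (hwm : Measurable w) (hwB : IndepFun w (fun ω t => B t ω) μ)
    {T₀ T : ℕ} (hT : 2 ≤ T) {v : Vec d} (hv : ‖v‖ = 1) (hAv : app A v = ‖A‖ • v)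
    {p η : ℝ} (hp : 8 ≤ p) (hη : η = 1 / (b * ‖A‖ * √(p * T))) :
    μ.real (goodInit T₀ B w v p) * (1 / (4 * Real.exp 7 * p)) ≤
      μ.real (goodInit T₀ B w v p ∩
        success A T₀ T η B w (24 * (Real.log T * b * √p / √T))) := by
  have ha : 0 < ‖A‖ := norm_pos_iff.2 h0
  have hη0 : 0 ≤ η := by rw [hη]; positivity
  set G := goodInit T₀ B w v p with hG
  set ε := 24 * (Real.log T * b * √p / √T) with hε
  -- If `ε ≥ 1`, the suboptimality bound always holds and only a nonzero final iterate is needed;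
  -- the potential argument requires `ε < 1`.
  rcases le_or_gt 1 ε with hε1 | hε1
  · have h1 : μ.real G ≤ μ.real (G ∩ success A T₀ T η B w ε) := by
      refine ENNReal.toReal_mono (measure_ne_top _ _) (measure_mono_ae ?_)
      filter_upwards [ae_all_iff.2 hBpos] with ω hω (hωG : ω ∈ G)
      refine ⟨hωG, norm_unitize ?_, (subopt_le_one hA _).trans hε1⟩
      refine sgdIter_ne_zero (B := fun t => B (T₀ + t) ω) hη0 (fun t => hω _) (fun h => ?_) T
      have := norm_powerInit_of_mem_goodInit hωG
      rw [h, norm_zero] at this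
      exact zero_ne_one this
    refine (mul_le_of_le_one_right measureReal_nonneg ?_).trans h1
    rw [div_le_one (by positivity)]
    have : 1 ≤ Real.exp 7 := Real.one_le_exp (by norm_num)
    nlinarith
  obtain ⟨u, s, hu, hs0, hs⟩ := exists_eigenbasis hA
  set S := ‖A‖⁻¹ • A with hS
  have hentry : ∀ (M : Matrix (Fin d) (Fin d) ℝ) i j, (‖A‖⁻¹ • M) i j = ‖A‖⁻¹ * M i j :=
    fun _ _ _ => rfl
  have key := measure_potential_neg_ge (μ := μ) (S := S) (h := η * ‖A‖) (b := b) (u := u)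
    (s := fun i => s i / ‖A‖) (v := v) (X := fun t ω => ‖A‖⁻¹ • B (T₀ + t) ω) (G := G) (p := p)
    (x := fun t ω => sgdIter η (fun t => B (T₀ + t) ω) (powerInit T₀ (fun t => B t ω) (w ω)) t)
    (T := T) (ε := ε)
    (by
      ext i j
      have := hA.1.apply i j
      simp only [Matrix.conjTranspose_apply, hS, hentry, star_trivial] at this ⊢
      rw [this])
    (by rw [hS, norm_smul, norm_inv, norm_norm, inv_mul_cancel₀ ha.ne'])
    (fun i => by rw [hS, app_smul_left, hu, smul_smul, div_eq_inv_mul])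
    (fun i => div_nonneg (hs0 i) ha.le) (fun i => (div_le_one ha).2 (hs i)) hv
    (by rw [hS, app_smul_left, hAv, smul_smul, inv_mul_cancel₀ ha.ne', one_smul])
    (fun t => Measurable.matrix_smul _ (hBm _))
    (fun t i j => by simpa only [hentry] using (hBi (T₀ + t) i j).const_mul _)
    (fun t i j => by
      simp only [hS, hentry]
      rw [integral_const_mul, hBA])
    (fun t => by
      filter_upwards [hBb (T₀ + t)] with ω hω
      rw [hS, ← smul_sub, norm_smul, norm_smul, norm_inv, norm_norm, inv_mul_eq_div,
        inv_mul_eq_div]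
      exact hω)
    (fun t => Measurable.sgdIter η (fun i => hBm _) (Measurable.powerInit T₀ hBm hwm) t)
    (fun t ω => by
      rw [sgdIter, smul_smul, mul_assoc, mul_inv_cancel₀ ha.ne', mul_one])
    (measurableSet_goodInit hBm hwm T₀ p v)
    (fun ω hω => norm_powerInit_of_mem_goodInit hω)
    (fun ω hω => by
      have h1 : 0 < inner ℝ v (powerInit T₀ (fun t => B t ω) (w ω)) ^ 2 := by
        have := hω.1
        positivity
      exact (one_div_le h1 (by linarith)).1 hω.2)
    (fun t => (indepFun_sgdIter hBm hB hwm hwB T₀ η p v t).comp measurable_id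
      (Measurable.matrix_smul _ measurable_id))
    hb hp hT (by rw [hη]; field_simp) hε hε1
  refine key.trans (measureReal_mono ?_)
  rintro ω ⟨hωG, hω⟩
  exact ⟨hωG, subopt_unitize_le hA.1 hu hω⟩

end Algorithm

end StreamPCA

/-! ### Assembly of the constants -/

theorem corollary2 :
    -- `c`: number of initial samples; `C`: the value of `p`; `q`: probability of a good start;
    -- `c₁`, `c₁'`: constants of the SGD theorem; `c₂`, `c₂'`: constants of the final bound
    ∃ c C q c₁ c₁' c₂ c₂' : ℝ,
      0 < c ∧ 0 < C ∧ 0 < q ∧ 0 < c₁ ∧ 0 < c₁' ∧ 0 < c₂ ∧ 0 < c₂' ∧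
      ∀ (d : ℕ), 2 ≤ d →
      ∀ (Ω : Type*) [MeasurableSpace Ω] (μ : Measure Ω) [IsProbabilityMeasure μ]
        (A : Matrix (Fin d) (Fin d) ℝ) (B : ℕ → Ω → Matrix (Fin d) (Fin d) ℝ)
        (w : Ω → Vec d) (b : ℝ) (T₀ T : ℕ),
      A.PosSemidef → A ≠ 0 → 1 ≤ b →
      -- the stream: i.i.d. positive semidefinite matrices with mean `A`, bounded by `b`
      (∀ t, Measurable (B t)) → iIndepFun B μ → (∀ t, IdentDistrib (B t) (B 0) μ μ) →
      (∀ t, ∀ᵐ ω ∂μ, (B t ω).PosSemidef) →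
      (∀ t i j, Integrable (fun ω => B t ω i j) μ ∧ ∫ ω, B t ω i j ∂μ = A i j) →
      (∀ t, ∀ᵐ ω ∂μ, ‖B t ω‖ / ‖A‖ ≤ b ∧ ‖B t ω - A‖ / ‖A‖ ≤ b) →
      -- a standard Gaussian vector, independent of the stream
      Measurable w → HasLaw w (stdGaussian (Vec d)) μ → IndepFun w (fun ω t => B t ω) μ →
      c * d * b ^ 2 * Real.log d ≤ T₀ → 2 ≤ T →
      ∀ (p η : ℝ), p = C * (Real.log d * numRank A) → η = 1 / (b * ‖A‖ * √(p * T)) →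
        -- the SGD theorem applies with this `p`
        (8 ≤ p ∧ η * ‖A‖ ≤ 1) ∧
        (∀ v : Vec d, IsLeadingEigenvector A v →
          q ≤ μ.real (goodInit T₀ B w v p) ∧
          μ.real (goodInit T₀ B w v p) * (1 / (c₁ * p)) ≤
            μ.real (goodInit T₀ B w v p ∩
              success A T₀ T η B w (c₁' * (Real.log T * b * √p / √T)))) ∧
        -- the resulting guarantee
        c₂ / (numRank A * Real.log d) ≤
          μ.real (success A T₀ T η B w
            (c₂' * (Real.log T * b * √(Real.log d * numRank A) / √T))) := by
  -- `C = 500` gives `336 n_A ≤ p`, as `500 · 0.69 = 345`, and also `p ≥ 8`. `c₂ = q / (c₁ C)` and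
  -- `c₂' = c₁' √C` come from substituting `p`.
  refine ⟨300, 500, 0.4, 4 * Real.exp 7, 24, 0.4 / (4 * Real.exp 7 * 500), 24 * √500,
    by norm_num, by norm_num, by norm_num, by positivity, by norm_num, by positivity,
    by positivity, ?_⟩
  intro d hd Ω _ μ _ A B w b T₀ T hA h0 hb hBm hB _ hBpos hBA hBb hwm hw hwB hT₀ hT p η hp hη
  have ha : 0 < ‖A‖ := norm_pos_iff.2 h0
  have hr : 1 ≤ numRank A := one_le_numRank h0
  have hL : 0.69 ≤ Real.log d := by
    have := Real.log_le_log (by norm_num) (show (2 : ℝ) ≤ d by exact_mod_cast hd)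
    linarith [Real.log_two_gt_d9]
  have hp8 : 8 ≤ p := by
    rw [hp]
    nlinarith
  have hT' : (2 : ℝ) ≤ T := by exact_mod_cast hT
  have hmain : ∀ v : Vec d, IsLeadingEigenvector A v →
      0.4 ≤ μ.real (goodInit T₀ B w v p) ∧
      μ.real (goodInit T₀ B w v p) * (1 / (4 * Real.exp 7 * p)) ≤
        μ.real (goodInit T₀ B w v p ∩
          success A T₀ T η B w (24 * (Real.log T * b * √p / √T))) := by
    intro v hv
    refine ⟨goodInit_prob_ge hd hA.1 h0 hBm hB (fun t i j => (hBA t i j).1)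
      (fun t i j => (hBA t i j).2) hb (fun t => ?_) hwm hw hwB hT₀ hv.1 (hv.app_eq hA h0) hp,
      measure_goodInit_inter_success_ge hA h0 hBm hB hBpos (fun t i j => (hBA t i j).1)
      (fun t i j => (hBA t i j).2) hb hBb hwm hwB hT hv.1 (hv.app_eq hA h0) hp8 hη⟩
    filter_upwards [hBb t] with ω hω
    exact (div_le_iff₀ ha).1 hω.2
  refine ⟨⟨hp8, ?_⟩, hmain, ?_⟩
  · have h1 : η * ‖A‖ = 1 / (b * √(p * T)) := by rw [hη]; field_simp
    have h2 : 1 ≤ √(p * T) := by rw [Real.one_le_sqrt]; nlinarith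
    rw [h1, div_le_one (by positivity)]
    nlinarith
  · obtain ⟨v, hv⟩ := exists_isLeadingEigenvector hA h0
    obtain ⟨h1, h2⟩ := hmain v hv
    have hε : 24 * √500 * (Real.log T * b * √(Real.log d * numRank A) / √T) =
        24 * (Real.log T * b * √p / √T) := by
      rw [hp, Real.sqrt_mul (by norm_num : (0 : ℝ) ≤ 500) (Real.log d * numRank A)]
      ring
    rw [hε]
    calc 0.4 / (4 * Real.exp 7 * 500) / (numRank A * Real.log d)
        = 0.4 * (1 / (4 * Real.exp 7 * p)) := by rw [hp]; field_simp
      _ ≤ μ.real (goodInit T₀ B w v p) * (1 / (4 * Real.exp 7 * p)) := by gcongr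
      _ ≤ _ := h2.trans (measureReal_mono Set.inter_subset_right)
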